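/- Let $X$ be a separable complex Banach space, $T>0$, $\mathcal I=[0,T]$, $\mathcal I_0=(0,T]$, $p\in[1,\infty)$, and let $\{C(t)\}_{t\in\mathcal I}$ be a family of closed linear operators in $X$. Consider the non-autonomous Cauchy problem $$\dot u(t)=-C(t)u(t),\qquad u(s)=u_s\in X,\qquad 0<s\le t\le T. \tag{1}$$ Notation and definitions. In $L^p(\mathcal I,X)$ let $D_0f=\partial_tf$ with $\mathrm{dom}(D_0)=\{f\in W^{1,p}(\mathcal I,X): f(0)=0\}$, and let $(\mathcal Cf)(t)=C(t)f(t)$ with domain all $f\in L^p(\mathcal I,X)$ such that $f(t)\in\mathrm{dom}(C(t))$ for a.e. $t$ and $t\mapsto C(t)f(t)$ belongs to $L^p(\mathcal I,X)$. Put $\widetilde{\mathcal K}=D_0+\mathcal C$ with $\mathrm{dom}(\widetilde{\mathcal K})=\mathrm{dom}(D_0)\cap\mathrm{dom}(\mathcal C)$. For $\phi\in L^\infty(\mathcal I)$ let $M(\phi)$ be multiplication by $\phi$. A linear operator $A$ in a Banach space is a *generator* if there is a strongly continuous semigroup $\{S(\tau)\}_{\tau\ge0}$ of bounded operators with $Ax=\lim_{h\downarrow0}h^{-1}(x-S(h)x)$,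 where $\mathrm{dom}(A)$ is the set of all $x$ for which the limit exists; one then writes $S(\tau)=e^{-\tau A}$. A linear operator $\mathcal K$ in $L^p(\mathcal I,X)$ is an *evolution pre-generator* if (i) every $f\in\mathrm{dom}(\mathcal K)$ has a continuous representative on $\mathcal I$, and $M(\phi)\,\mathrm{dom}(\mathcal K)\subset\mathrm{dom}(\mathcal K)$ for all $\phi\in W^{1,\infty}(\mathcal I)$; (ii) $\mathcal KM(\phi)f-M(\phi)\mathcal Kf=M(\dot\phi)f$ for all $f\in\mathrm{dom}(\mathcal K)$ and $\phi\in W^{1,\infty}(\mathcal I)$; (iii) for every $t\in\mathcal I_0$ the values at $t$ of the continuous representatives of the elements of $\mathrm{dom}(\mathcal K)$ are dense in $X$. An *evolution generator* is an evolution pre-generator that is also a generator in $L^p(\mathcal I,X)$. A *propagator* is a strongly continuous, uniformly bounded family $\{U(t,s)\}_{0<s\le t\le T}$ of bounded operators on $X$ with $U(t,t)=I$ and $U(t,r)U(r,s)=U(t,s)$ for $0<s\le r\le t\le T$. It *corresponds* to an evolution generator $\mathcal K$ if for all $\tau\ge0$ and $f\in L^p(\mathcal I,X)$, for a.e. $t\in\mathcal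 I$, $(e^{-\tau\mathcal K}f)(t)=U(t,t-\tau)f(t-\tau)$ if $t>\tau$ and $(e^{-\tau\mathcal K}f)(t)=0$ if $t\le\tau$. Problem (1) is *correctly posed* in $\mathcal I_0$ if $\widetilde{\mathcal K}$ is an evolution pre-generator. In this case a propagator is a *solution operator* of (1) if it corresponds to an evolution generator that extends $\widetilde{\mathcal K}$, and (1) *has a unique solution operator* if $\widetilde{\mathcal K}$ admits exactly one extension that is an evolution generator. Theorem. Suppose that (1) is correctly posed in $\mathcal I_0$, that $\widetilde{\mathcal K}$ is closable in $L^p(\mathcal I,X)$, and that its closure $\mathcal K$ is a generator. Then $\mathcal K$ is an evolution generator, and every evolution generator that extends $\widetilde{\mathcal K}$ equals $\mathcal K$. Consequently (1) has a unique solution operator; in particular there is exactly one propagator $\{U(t,s)\}_{0<s\le t\le T}$ that is a solution operator of (1). -/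

import Mathlib

open MeasureTheory Filter Set
open scoped Topology ENNReal ContDiff

noncomputable section

namespace EvolCauchy

/-! ### Strongly continuous semigroups and generators (sign convention `S t = exp (-t A)`) -/

section Semigroups

variable {E : Type*} [NormedAddCommGroup E] [NormedSpace ℂ E]

/-- `S t`, `t ≥ 0`, is a strongly continuous semigroup of bounded operators
(values at negative times are irrelevant). -/
structure IsC0Semigroup (S : ℝ → E →L[ℂ] E) : Prop where
  zero : S 0 = 1
  add : ∀ s t : ℝ, 0 ≤ s → 0 ≤ t → S (s + t) = S s * S t
  continuousOn : ∀ x : E, ContinuousOn (fun t => S t x) (Ici 0)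

/-- `A` is the generator of the strongly continuous semigroup `S`, with the sign convention
`A x = lim_{h ↓ 0} h⁻¹ (x - S h x)`, on the domain of all `x` for which the limit exists. -/
def IsGeneratorOf (A : E →ₗ.[ℂ] E) (S : ℝ → E →L[ℂ] E) : Prop :=
  IsC0Semigroup S ∧
    ∀ x y : E, (x, y) ∈ A.graph ↔
      Tendsto (fun h : ℝ => h⁻¹ • (x - S h x)) (𝓝[>] 0) (𝓝 y)

/-- `A` is the generator of some strongly continuous semigroup. -/
def IsGenerator (A : E →ₗ.[ℂ] E) : Prop :=
  ∃ S : ℝ → E →L[ℂ] E, IsGeneratorOf A S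

end Semigroups

/-! ### The spaces `L^p([0,T], X)` and weak derivatives -/

/-- Lebesgue measure on the interval `[0,T]`. -/
abbrev intervalMeasure (T : ℝ) : Measure ℝ := volume.restrict (Icc 0 T)

/-- The space `L^p([0,T], X)`. -/
abbrev LpI (T : ℝ) (p : ℝ≥0∞) (X : Type*) [NormedAddCommGroup X] :=
  Lp X p (intervalMeasure T)

variable {X : Type*} [NormedAddCommGroup X] [NormedSpace ℂ X]

/-- `g` is the weak (distributional) derivative of `f` on the open interval `(0,T)`. -/
def HasWeakDeriv {Y : Type*} [NormedAddCommGroup Y] [NormedSpace ℝ Y]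
    (T : ℝ) (f g : ℝ → Y) : Prop :=
  ∀ η : ℝ → ℝ, ContDiff ℝ ∞ η → HasCompactSupport η → tsupport η ⊆ Ioo 0 T →
    ∫ t, deriv η t • f t ∂(intervalMeasure T) = - ∫ t, η t • g t ∂(intervalMeasure T)

/-- `u` is a continuous representative on `[0,T]` of the function class `f`. -/
def IsContRep (T : ℝ) (f u : ℝ → X) : Prop :=
  ContinuousOn u (Icc 0 T) ∧ f =ᵐ[intervalMeasure T] u

/-- The multiplication operator `M(φ)` on `L^p([0,T], X)`, `(M(φ) f)(t) = φ(t) f(t)`,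
for a scalar function `φ ∈ L^∞([0,T])`. -/
def mulScalar {T : ℝ} {p : ℝ≥0∞} [Fact (1 ≤ p)] (φ : LpI T ∞ ℂ) : LpI T p X →L[ℂ] LpI T p X :=
  (ContinuousLinearMap.lsmul ℂ ℂ : ℂ →L[ℂ] X →L[ℂ] X).holderL (intervalMeasure T) ∞ p p φ

theorem coeFn_mulScalar {T : ℝ} {p : ℝ≥0∞} [Fact (1 ≤ p)] (φ : LpI T ∞ ℂ) (f : LpI T p X) :
    mulScalar φ f =ᵐ[intervalMeasure T] fun t => φ t • f t :=
  ContinuousLinearMap.coeFn_holder _ φ f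

/-! ### Evolution pre-generators and evolution generators -/

/-- The set `D ⊆ L^p([0,T], X)` has a dense cross-section in `X`: it consists of (classes of)
continuous functions on `[0,T]`, and for every `t ∈ (0,T]` the values at `t` of the continuous
representatives of the elements of `D` are dense in `X`. -/
def HasDenseCrossSection {T : ℝ} {p : ℝ≥0∞} (D : Set (LpI T p X)) : Prop :=
  (∀ f ∈ D, ∃ u : ℝ → X, IsContRep T f u) ∧
    ∀ t ∈ Ioc 0 T, Dense {x : X | ∃ f ∈ D, ∃ u : ℝ → X, IsContRep T f u ∧ u t = x}

/-- Evolution pre-generators in `L^p([0,T], X)`. A pair `φ, φ'` of elements of `L^∞([0,T])`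
with `φ'` the weak derivative of `φ` is the same as an element `φ` of `W^{1,∞}([0,T])`. -/
structure IsEvolutionPreGenerator {T : ℝ} {p : ℝ≥0∞} [Fact (1 ≤ p)]
    (K : LpI T p X →ₗ.[ℂ] LpI T p X) : Prop where
  continuous_mem : ∀ f ∈ K.domain, ∃ u : ℝ → X, IsContRep T f u
  mul_mem : ∀ φ φ' : LpI T ∞ ℂ, HasWeakDeriv T φ φ' →
    ∀ f ∈ K.domain, mulScalar φ f ∈ K.domain
  commutator : ∀ (φ φ' : LpI T ∞ ℂ) (hφ : HasWeakDeriv T φ φ') (f : K.domain),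
    K ⟨mulScalar φ (f : LpI T p X), mul_mem φ φ' hφ f f.2⟩ - mulScalar φ (K f)
      = mulScalar φ' (f : LpI T p X)
  dense_crossSection : HasDenseCrossSection (K.domain : Set (LpI T p X))

/-- An evolution generator is an evolution pre-generator which is the generator of a
strongly continuous semigroup on `L^p([0,T], X)`. -/
def IsEvolutionGenerator {T : ℝ} {p : ℝ≥0∞} [Fact (1 ≤ p)]
    (K : LpI T p X →ₗ.[ℂ] LpI T p X) : Prop :=
  IsEvolutionPreGenerator K ∧ IsGenerator K

/-! ### The operators `D₀`, `𝒞` and `D₀ + 𝒞` -/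

theorem integrable_smul {T : ℝ} {p : ℝ≥0∞} [Fact (1 ≤ p)] {η : ℝ → ℝ} (hη : Continuous η)
    (hc : HasCompactSupport η) (f : LpI T p X) :
    Integrable (fun t => η t • f t) (intervalMeasure T) := by
  obtain ⟨C, hC⟩ := hη.bounded_above_of_compact_support hc
  refine (((Lp.memLp f).integrable Fact.out).norm.const_mul C).mono'
    (hη.aestronglyMeasurable.smul (Lp.aestronglyMeasurable f)) (Eventually.of_forall fun t => ?_)
  rw [norm_smul]
  exact mul_le_mul_of_nonneg_right (hC t) (norm_nonneg _)

variable (X) in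
/-- The graph of `D₀ = ∂_t` with domain `{f ∈ W^{1,p}([0,T], X) : f(0) = 0}`: the pairs `(f, g)`
in `L^p` such that `g` is the weak derivative of `f` and the continuous representative of `f`
vanishes at `0`. -/
def derivGraph (T : ℝ) (p : ℝ≥0∞) [Fact (1 ≤ p)] : Submodule ℂ (LpI T p X × LpI T p X) where
  carrier := {q | HasWeakDeriv T q.1 q.2 ∧ ∃ u : ℝ → X, IsContRep T q.1 u ∧ u 0 = 0}
  zero_mem' := by
    have h0 : ((0 : LpI T p X) : ℝ → X) =ᵐ[intervalMeasure T] 0 := Lp.coeFn_zero _ _ _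
    refine ⟨fun η _ _ _ => ?_, 0, ⟨continuousOn_const, h0⟩, rfl⟩
    have e1 : ∫ t, deriv η t • (0 : LpI T p X) t ∂(intervalMeasure T) = 0 :=
      integral_eq_zero_of_ae (h0.mono fun t ht => by simp only [ht, Pi.zero_apply, smul_zero])
    have e2 : ∫ t, η t • (0 : LpI T p X) t ∂(intervalMeasure T) = 0 :=
      integral_eq_zero_of_ae (h0.mono fun t ht => by simp only [ht, Pi.zero_apply, smul_zero])
    exact e1.trans (neg_eq_zero.2 e2).symm
  add_mem' := by
    rintro ⟨f, g⟩ ⟨f', g'⟩ ⟨h, u, ⟨hu, hfu⟩, h0⟩ ⟨h', u', ⟨hu', hfu'⟩, h0'⟩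
    refine ⟨fun η hη hc hs => ?_, u + u', ⟨hu.add hu', ?_⟩, by simp [h0, h0']⟩
    · have hd : Continuous (deriv η) := hη.continuous_deriv (by simp)
      have e1 : ∫ t, deriv η t • (f + f' : LpI T p X) t ∂(intervalMeasure T)
          = ∫ t, (deriv η t • f t + deriv η t • f' t) ∂(intervalMeasure T) :=
        integral_congr_ae ((Lp.coeFn_add f f').mono fun t ht => by simp only [ht, Pi.add_apply, smul_add])
      have e2 : ∫ t, η t • (g + g' : LpI T p X) t ∂(intervalMeasure T)
          = ∫ t, (η t • g t + η t • g' t) ∂(intervalMeasure T) :=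
        integral_congr_ae ((Lp.coeFn_add g g').mono fun t ht => by simp only [ht, Pi.add_apply, smul_add])
      rw [integral_add (integrable_smul hd hc.deriv f) (integrable_smul hd hc.deriv f')] at e1
      rw [integral_add (integrable_smul hη.continuous hc g)
        (integrable_smul hη.continuous hc g')] at e2
      have a := h η hη hc hs
      have b := h' η hη hc hs
      simp only at a b
      change ∫ t, deriv η t • (f + f' : LpI T p X) t ∂(intervalMeasure T)
        = - ∫ t, η t • (g + g' : LpI T p X) t ∂(intervalMeasure T)
      rw [e1, e2, a, b, neg_add]
    · exact (Lp.coeFn_add f f').trans (hfu.add hfu')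
  smul_mem' := by
    rintro c ⟨f, g⟩ ⟨h, u, ⟨hu, hfu⟩, h0⟩
    refine ⟨fun η hη hc hs => ?_, c • u, ⟨hu.const_smul c, ?_⟩, by simp [h0]⟩
    · have e1 : ∫ t, deriv η t • (c • f : LpI T p X) t ∂(intervalMeasure T)
          = ∫ t, c • (deriv η t • f t) ∂(intervalMeasure T) :=
        integral_congr_ae ((Lp.coeFn_smul c f).mono fun t ht => by simp [ht, smul_comm c])
      have e2 : ∫ t, η t • (c • g : LpI T p X) t ∂(intervalMeasure T)
          = ∫ t, c • (η t • g t) ∂(intervalMeasure T) :=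
        integral_congr_ae ((Lp.coeFn_smul c g).mono fun t ht => by simp [ht, smul_comm c])
      have a := h η hη hc hs
      simp only at a
      change ∫ t, deriv η t • (c • f : LpI T p X) t ∂(intervalMeasure T)
        = - ∫ t, η t • (c • g : LpI T p X) t ∂(intervalMeasure T)
      rw [e1, e2, integral_smul, integral_smul, a, smul_neg]
    · exact (Lp.coeFn_smul c f).trans (hfu.const_smul c)

/-- Weak derivatives are unique, so `derivGraph` is the graph of an operator. -/
theorem derivGraph_functional [CompleteSpace X] {T : ℝ} {p : ℝ≥0∞} [Fact (1 ≤ p)]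
    (q : LpI T p X × LpI T p X) (hq : q ∈ derivGraph X T p) (h1 : q.1 = 0) : q.2 = 0 := by
  obtain ⟨f, g⟩ := q
  obtain rfl : f = 0 := h1
  obtain ⟨h, -⟩ := hq
  have hI : Integrable g (intervalMeasure T) := (Lp.memLp g).integrable Fact.out
  have key : ∀ᵐ t ∂(intervalMeasure T), t ∈ Ioo 0 T → g t = 0 := by
    refine isOpen_Ioo.ae_eq_zero_of_integral_contDiff_smul_eq_zero
      (hI.locallyIntegrable.locallyIntegrableOn _) fun η hη hc hs => ?_
    have a := h η hη hc hs
    have e1 : ∫ t, deriv η t • (0 : LpI T p X) t ∂(intervalMeasure T) = 0 :=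
      integral_eq_zero_of_ae ((Lp.coeFn_zero X p (intervalMeasure T)).mono
        fun t ht => by simp only [ht, Pi.zero_apply, smul_zero])
    exact neg_eq_zero.1 (a.symm.trans e1)
  refine Lp.ext ?_
  have hmem : ∀ᵐ t ∂(intervalMeasure T), t ∈ Ioo 0 T := by
    rw [intervalMeasure, ← restrict_Ioo_eq_restrict_Icc]
    exact ae_restrict_mem measurableSet_Ioo
  filter_upwards [key, hmem, Lp.coeFn_zero X p (intervalMeasure T)] with t h2 h3 h4
  rw [h2 h3, h4, Pi.zero_apply]

variable (X) in
/-- The operator `D₀ = ∂_t` in `L^p([0,T], X)`, `dom D₀ = {f ∈ W^{1,p}([0,T], X) : f(0) = 0}`. -/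
def D₀ (T : ℝ) (p : ℝ≥0∞) [Fact (1 ≤ p)] : LpI T p X →ₗ.[ℂ] LpI T p X :=
  (derivGraph X T p).toLinearPMap

theorem graph_D₀ [CompleteSpace X] (T : ℝ) (p : ℝ≥0∞) [Fact (1 ≤ p)] :
    (D₀ X T p).graph = derivGraph X T p :=
  Submodule.toLinearPMap_graph_eq _ derivGraph_functional

/-- The graph of the multiplication operator induced by the family `C`: the pairs `(f, g)` in
`L^p` with `f(t) ∈ dom C(t)` and `C(t) f(t) = g(t)` for almost every `t ∈ [0,T]`. -/
def mulGraph (T : ℝ) (p : ℝ≥0∞) (C : ℝ → X →ₗ.[ℂ] X) :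
    Submodule ℂ (LpI T p X × LpI T p X) where
  carrier := {q | ∀ᵐ t ∂(intervalMeasure T), (q.1 t, q.2 t) ∈ (C t).graph}
  zero_mem' := by
    filter_upwards [Lp.coeFn_zero X p (intervalMeasure T)] with t h
    simp only [Prod.fst_zero, Prod.snd_zero, h, Pi.zero_apply]
    exact (C t).graph.zero_mem
  add_mem' := by
    rintro ⟨f, g⟩ ⟨f', g'⟩ h h'
    filter_upwards [h, h', Lp.coeFn_add f f', Lp.coeFn_add g g'] with t h1 h2 h3 h4
    have h5 := (C t).graph.add_mem h1 h2
    rw [Prod.fst_add, Prod.snd_add, h3, h4]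
    exact h5
  smul_mem' := by
    rintro c ⟨f, g⟩ h
    filter_upwards [h, Lp.coeFn_smul c f, Lp.coeFn_smul c g] with t h1 h3 h4
    simpa [h3, h4] using (C t).graph.smul_mem c h1

theorem mulGraph_functional {T : ℝ} {p : ℝ≥0∞} {C : ℝ → X →ₗ.[ℂ] X}
    (q : LpI T p X × LpI T p X) (hq : q ∈ mulGraph T p C) (h1 : q.1 = 0) : q.2 = 0 := by
  obtain ⟨f, g⟩ := q
  obtain rfl : f = 0 := h1
  have hq' : ∀ᵐ t ∂(intervalMeasure T), ((0 : LpI T p X) t, g t) ∈ (C t).graph := hq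
  refine Lp.ext ?_
  filter_upwards [hq', Lp.coeFn_zero X p (intervalMeasure T)] with t h2 h3
  rw [h3]
  rw [h3] at h2
  exact (C t).graph_fst_eq_zero_snd h2 rfl

/-- The multiplication operator `𝒞` in `L^p([0,T], X)` induced by the family `C`:
`(𝒞 f)(t) = C(t) f(t)` on the domain of all `f ∈ L^p` such that `f(t) ∈ dom C(t)` for almost
every `t` and `t ↦ C(t) f(t)` belongs to `L^p`. -/
def inducedMul (T : ℝ) (p : ℝ≥0∞) (C : ℝ → X →ₗ.[ℂ] X) : LpI T p X →ₗ.[ℂ] LpI T p X :=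
  (mulGraph T p C).toLinearPMap

theorem graph_inducedMul (T : ℝ) (p : ℝ≥0∞) (C : ℝ → X →ₗ.[ℂ] X) :
    (inducedMul T p C).graph = mulGraph T p C :=
  Submodule.toLinearPMap_graph_eq _ mulGraph_functional

/-- The operator `D₀ + 𝒞` in `L^p([0,T], X)`, with domain `dom D₀ ∩ dom 𝒞`. -/
def preGen (T : ℝ) (p : ℝ≥0∞) [Fact (1 ≤ p)] (C : ℝ → X →ₗ.[ℂ] X) :
    LpI T p X →ₗ.[ℂ] LpI T p X :=
  D₀ X T p + inducedMul T p C

/-! ### The non-autonomous Cauchy problem `u'(t) = - C(t) u(t)`, `u(s) = u_s` -/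

/-- The Cauchy problem is correctly posed in `(0,T]` if `D₀ + 𝒞` is an evolution
pre-generator. -/
def IsCorrectlyPosed (T : ℝ) (p : ℝ≥0∞) [Fact (1 ≤ p)] (C : ℝ → X →ₗ.[ℂ] X) : Prop :=
  IsEvolutionPreGenerator (preGen T p C)

/-- Propagators on `Δ = {(t,s) : 0 < s ≤ t ≤ T}`; values of `U` outside of `Δ` are irrelevant. -/
structure IsPropagator (T : ℝ) (U : ℝ → ℝ → X →L[ℂ] X) : Prop where
  continuousOn : ∀ x : X, ContinuousOn (fun q : ℝ × ℝ => U q.1 q.2 x)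
    {q : ℝ × ℝ | 0 < q.2 ∧ q.2 ≤ q.1 ∧ q.1 ≤ T}
  refl : ∀ t, 0 < t → t ≤ T → U t t = 1
  comp : ∀ t r s, 0 < s → s ≤ r → r ≤ t → t ≤ T → U t r * U r s = U t s
  bounded : ∃ M : ℝ, ∀ t s, 0 < s → s ≤ t → t ≤ T → ‖U t s‖ ≤ M

/-- The semigroup `S` on `L^p([0,T], X)` and the propagator `U` correspond to each other:
`(S(τ) f)(t) = U(t, t - τ) f(t - τ)` for almost every `t ∈ (τ, T]`, and `(S(τ) f)(t) = 0` for
almost every `t ∈ [0, τ]`. -/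
def Corresponds {T : ℝ} {p : ℝ≥0∞} [Fact (1 ≤ p)]
    (S : ℝ → LpI T p X →L[ℂ] LpI T p X) (U : ℝ → ℝ → X →L[ℂ] X) : Prop :=
  ∀ τ : ℝ, 0 ≤ τ → ∀ f : LpI T p X, ∀ᵐ t ∂(intervalMeasure T),
    S τ f t = if τ < t then U t (t - τ) (f (t - τ)) else 0

/-- A propagator `U` is a solution operator of the Cauchy problem if the corresponding evolution
generator `K` is an extension of `D₀ + 𝒞`. -/
def IsSolutionOperator (T : ℝ) (p : ℝ≥0∞) [Fact (1 ≤ p)] (C : ℝ → X →ₗ.[ℂ] X)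
    (U : ℝ → ℝ → X →L[ℂ] X) : Prop :=
  IsPropagator T U ∧
    ∃ (K : LpI T p X →ₗ.[ℂ] LpI T p X) (S : ℝ → LpI T p X →L[ℂ] LpI T p X),
      IsEvolutionGenerator K ∧ IsGeneratorOf K S ∧ Corresponds S U ∧ preGen T p C ≤ K

/-- The Cauchy problem has a unique solution operator: `D₀ + 𝒞` admits exactly one extension
that is an evolution generator. -/
def HasUniqueSolutionOperator (T : ℝ) (p : ℝ≥0∞) [Fact (1 ≤ p)] (C : ℝ → X →ₗ.[ℂ] X) : Prop :=
  ∃! K : LpI T p X →ₗ.[ℂ] LpI T p X, preGen T p C ≤ K ∧ IsEvolutionGenerator K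

end EvolCauchy

end

namespace EvolCauchy

/-! ### Strongly continuous semigroups -/

section Semigroups

variable {E : Type*} [NormedAddCommGroup E] [NormedSpace ℂ E]

/-! Uniqueness is general semigroup theory. A generator is closed (`IsGeneratorOf.isClosed`), so one
that extends $\widetilde{\mathcal K}$ extends the closure $\mathcal K$; and a generator has no
proper extension that is a generator (`IsGeneratorOf.eq_of_le`), because orbits of the smaller one
solve the equation of the larger one.

That $\mathcal K$ is an evolution generator rests on the commutator with the coordinate function
$t$, an identity between graphs that survives closure. It gives $S(\tau)t=(t-\tau)S(\tau)$
(`semigroup_mulCoord`), then the same for polynomials. By the Weierstrass theorem and a comparison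
of measures, $\|(S(\tau)f)(t)\|\le\|S(\tau)\|\,\|f(t-\tau)\|$ a.e., with value $0$ for $t<\tau$
(`ae_norm_semigroup_le`). So $S(T)=0$, and $f=\int_0^T S(\sigma)\mathcal Kf\,d\sigma$ yields
$\|f\|_\infty\le c\|\mathcal Kf\|_p$. Graph convergence is therefore uniform convergence, and
elements of the domain of the closure are continuous.

The propagator is forced to be $U(t,s)f(s)=(S(t-s)f)(t)$ for $f$ in the domain. The pointwise
estimate makes this well defined and bounded on the dense set of values $f(s)$. Testing on constant
functions shows that the semigroup determines $U$. -/

theorem hasDerivWithinAt_Ici_iff {F : Type*} [NormedAddCommGroup F] [NormedSpace ℝ F]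
    {u : ℝ → F} {v : F} {t : ℝ} :
    HasDerivWithinAt u v (Ici t) t ↔
      Tendsto (fun h : ℝ => h⁻¹ • (u (t + h) - u t)) (𝓝[>] 0) (𝓝 v) := by
  rw [← hasDerivWithinAt_Ioi_iff_Ici, hasDerivWithinAt_iff_tendsto_slope' self_notMem_Ioi]
  have : 𝓝[>] t = map (fun h => t + h) (𝓝[>] 0) := by simp
  rw [this, tendsto_map'_iff]
  simp [Function.comp_def, slope_def_module]

theorem IsC0Semigroup.exists_bound [CompleteSpace E] {S : ℝ → E →L[ℂ] E} (hS : IsC0Semigroup S)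
    (τ : ℝ) : ∃ M, 0 ≤ M ∧ ∀ σ ∈ Icc 0 τ, ‖S σ‖ ≤ M := by
  obtain ⟨C, hC⟩ := banach_steinhaus (g := fun σ : Icc (0 : ℝ) τ => S σ) fun x => by
    obtain ⟨C, hC⟩ := isCompact_Icc.exists_bound_of_continuousOn
      ((hS.continuousOn x).mono (Icc_subset_Ici_self : Icc (0 : ℝ) τ ⊆ Ici 0))
    exact ⟨C, fun i => hC i i.2⟩
  exact ⟨max C 0, le_max_right _ _, fun σ hσ => (hC ⟨σ, hσ⟩).trans (le_max_left _ _)⟩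

/-- Local boundedness, from Banach–Steinhaus, upgrades strong continuity to joint continuity. -/
theorem IsC0Semigroup.tendsto_apply [CompleteSpace E] {S : ℝ → E →L[ℂ] E} (hS : IsC0Semigroup S)
    {ι : Type*} {l : Filter ι} {α : ι → ℝ} {w : ι → E} {a : ℝ} {x : E} (ha : 0 ≤ a)
    (hα : Tendsto α l (𝓝 a)) (h0 : ∀ᶠ i in l, 0 ≤ α i) (hw : Tendsto w l (𝓝 x)) :
    Tendsto (fun i => S (α i) (w i)) l (𝓝 (S a x)) := by
  obtain ⟨M, hM0, hM⟩ := hS.exists_bound (a + 1)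
  have h1 : Tendsto (fun i => S (α i) x) l (𝓝 (S a x)) :=
    (hS.continuousOn x a ha).tendsto.comp (tendsto_nhdsWithin_iff.2 ⟨hα, h0⟩)
  have h2 : Tendsto (fun i => S (α i) (w i - x)) l (𝓝 0) := by
    have h3 : Tendsto (fun i => M * ‖w i - x‖) l (𝓝 0) := by
      simpa using ((hw.sub_const x).norm.const_mul M)
    refine squeeze_zero_norm' ?_ h3
    filter_upwards [h0, hα.eventually_le_const (lt_add_one a)] with i hi hi'
    exact (S (α i)).le_of_opNorm_le (hM _ ⟨hi, hi'⟩) _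
  simpa using h2.add h1

theorem IsC0Semigroup.continuousOn_comp [CompleteSpace E] {S : ℝ → E →L[ℂ] E}
    (hS : IsC0Semigroup S) {Y : Type*} [TopologicalSpace Y] {s : Set Y} {α : Y → ℝ} {w : Y → E}
    (hα : ContinuousOn α s) (h0 : ∀ y ∈ s, 0 ≤ α y) (hw : ContinuousOn w s) :
    ContinuousOn (fun y => S (α y) (w y)) s := fun y hy =>
  hS.tendsto_apply (h0 y hy) (hα y hy) (eventually_mem_nhdsWithin.mono h0) (hw y hy)

theorem IsGeneratorOf.mem_orbit {A : E →ₗ.[ℂ] E} {S : ℝ → E →L[ℂ] E} (hA : IsGeneratorOf A S)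
    {x y : E} (hxy : (x, y) ∈ A.graph) {t : ℝ} (ht : 0 ≤ t) : (S t x, S t y) ∈ A.graph := by
  refine (hA.2 _ _).2 ((((S t).continuous.tendsto y).comp ((hA.2 _ _).1 hxy)).congr' ?_)
  filter_upwards [self_mem_nhdsWithin] with h hh
  have hh : (0 : ℝ) < h := hh
  have e : S h (S t x) = S t (S h x) := by
    change (S h * S t) x = (S t * S h) x
    rw [← hA.1.add _ _ hh.le ht, ← hA.1.add _ _ ht hh.le, add_comm]
  simp only [Function.comp_apply, ContinuousLinearMap.map_smul_of_tower, map_sub, e]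

theorem IsGeneratorOf.hasDerivWithinAt {A : E →ₗ.[ℂ] E} {S : ℝ → E →L[ℂ] E}
    (hA : IsGeneratorOf A S) {x y : E} (hxy : (x, y) ∈ A.graph) {t : ℝ} (ht : 0 ≤ t) :
    HasDerivWithinAt (fun σ => S σ x) (-S t y) (Ici t) t := by
  rw [hasDerivWithinAt_Ici_iff]
  refine ((hA.2 _ _).1 (hA.mem_orbit hxy ht)).neg.congr' ?_
  filter_upwards [self_mem_nhdsWithin] with h hh
  have hh : (0 : ℝ) < h := hh
  rw [← smul_neg, neg_sub, add_comm t h, hA.1.add _ _ hh.le ht]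
  rfl

/-- Strong solutions of `w' = - A w` are orbits of the semigroup generated by `A`. -/
theorem IsGeneratorOf.eq_orbit [CompleteSpace E] {A : E →ₗ.[ℂ] E} {S : ℝ → E →L[ℂ] E}
    (hA : IsGeneratorOf A S) {w w' : ℝ → E} {τ : ℝ} (hτ : 0 ≤ τ)
    (hc : ContinuousOn w (Icc 0 τ)) (hmem : ∀ σ ∈ Ico 0 τ, (w σ, w' σ) ∈ A.graph)
    (hd : ∀ σ ∈ Ico 0 τ, HasDerivWithinAt w (-w' σ) (Ici σ) σ) : w τ = S τ (w 0) := by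
  have key := constant_of_has_deriv_right_zero (f := fun σ => S (τ - σ) (w σ)) (a := 0) (b := τ)
    (hA.1.continuousOn_comp (by fun_prop) (fun y hy => sub_nonneg.2 hy.2) hc) fun σ hσ => by
      rw [hasDerivWithinAt_Ici_iff]
      have h1 := hasDerivWithinAt_Ici_iff.1 (hd σ hσ)
      have h2 := (hA.2 _ _).1 (hmem σ hσ)
      -- To first order `w` moves along the semigroup, so $S(\tau-\sigma)w(\sigma)$ has right
      -- derivative zero.
      have h3 : Tendsto (fun h : ℝ => h⁻¹ • (w (σ + h) - S h (w σ))) (𝓝[>] 0) (𝓝 0) := by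
        have := h1.add h2
        rw [neg_add_cancel] at this
        refine this.congr fun h => ?_
        rw [← smul_add, sub_add_sub_cancel]
      have hlt : ∀ᶠ h : ℝ in 𝓝[>] 0, h < τ - σ :=
        (tendsto_id.mono_left nhdsWithin_le_nhds).eventually_lt_const (sub_pos.2 hσ.2)
      have h4 := hA.1.tendsto_apply (α := fun h : ℝ => τ - σ - h) (a := τ - σ)
        (sub_nonneg.2 hσ.2.le) (l := 𝓝[>] 0) ?_ ?_ h3
      · rw [map_zero] at h4
        refine h4.congr' ?_
        filter_upwards [self_mem_nhdsWithin, hlt] with h hh hh'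
        have hh : (0 : ℝ) < h := hh
        have e : S (τ - σ) (w σ) = S (τ - σ - h) (S h (w σ)) := by
          change _ = (S _ * S _) _
          rw [← hA.1.add _ _ (by linarith) hh.le, sub_add_cancel]
        rw [ContinuousLinearMap.map_smul_of_tower, map_sub, e, sub_add_eq_sub_sub]
      · have : Tendsto (fun h : ℝ => τ - σ - h) (𝓝 0) (𝓝 (τ - σ - 0)) :=
          (continuous_const.sub continuous_id).tendsto 0
        rw [sub_zero] at this
        exact this.mono_left nhdsWithin_le_nhds
      · filter_upwards [hlt] with h hh
        linarith
  have h := key τ ⟨hτ, le_rfl⟩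
  simpa [hA.1.zero] using h

theorem IsC0Semigroup.intervalIntegrable {S : ℝ → E →L[ℂ] E} (hS : IsC0Semigroup S) (x : E)
    {a b : ℝ} (ha : 0 ≤ a) (hb : 0 ≤ b) :
    IntervalIntegrable (fun σ => S σ x) volume a b :=
  ((hS.continuousOn x).mono fun _ h => (le_min ha hb).trans h.1).intervalIntegrable

theorem IsGeneratorOf.sub_eq_integral [CompleteSpace E] {A : E →ₗ.[ℂ] E} {S : ℝ → E →L[ℂ] E}
    (hA : IsGeneratorOf A S) {x y : E} (hxy : (x, y) ∈ A.graph) {h : ℝ} (hh : 0 ≤ h) :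
    x - S h x = ∫ σ in (0 : ℝ)..h, S σ y := by
  have := intervalIntegral.integral_eq_sub_of_hasDeriv_right (f := fun σ => S σ x)
    (f' := fun σ => -S σ y) (a := 0) (b := h)
    ((hA.1.continuousOn x).mono fun _ hσ => (le_min le_rfl hh).trans hσ.1)
    (fun σ hσ => (hA.hasDerivWithinAt hxy ((le_min le_rfl hh).trans hσ.1.le)).mono Ioi_subset_Ici_self)
    (hA.1.intervalIntegrable y le_rfl hh).neg
  rw [intervalIntegral.integral_neg] at this
  rw [← neg_inj, this, hA.1.zero]
  simp

theorem IsC0Semigroup.tendsto_average [CompleteSpace E] {S : ℝ → E →L[ℂ] E}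
    (hS : IsC0Semigroup S) (y : E) :
    Tendsto (fun h : ℝ => h⁻¹ • ∫ σ in (0 : ℝ)..h, S σ y) (𝓝[>] 0) (𝓝 y) := by
  have h1 : HasDerivWithinAt (fun u => ∫ σ in (0 : ℝ)..u, S σ y) (S 0 y) (Ici 0) 0 :=
    intervalIntegral.integral_hasDerivWithinAt_right (t := Ioi 0)
      (hS.intervalIntegrable y le_rfl le_rfl)
      ⟨Ioi 0, self_mem_nhdsWithin, ((hS.continuousOn y).mono Ioi_subset_Ici_self).aestronglyMeasurable
        measurableSet_Ioi⟩
      ((hS.continuousOn y 0 self_mem_Ici).mono Ioi_subset_Ici_self)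
  simpa [hS.zero] using hasDerivWithinAt_Ici_iff.1 h1

/-- The integrated equation replaces a limit by conditions at each fixed $h$, which are closed in
$(x,y)$ and can be checked directly; averaging over $[0,h]$ recovers the limit. -/
theorem IsGeneratorOf.mem_graph_iff [CompleteSpace E] {A : E →ₗ.[ℂ] E} {S : ℝ → E →L[ℂ] E}
    (hA : IsGeneratorOf A S) {x y : E} :
    (x, y) ∈ A.graph ↔ ∀ h : ℝ, 0 ≤ h → x - S h x = ∫ σ in (0 : ℝ)..h, S σ y := by
  refine ⟨fun hxy h hh => hA.sub_eq_integral hxy hh, fun H => (hA.2 _ _).2 ?_⟩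
  refine (hA.1.tendsto_average y).congr' ?_
  filter_upwards [self_mem_nhdsWithin] with h hh
  have hh : (0 : ℝ) < h := hh
  rw [H h hh.le]

theorem IsC0Semigroup.norm_integral_le {S : ℝ → E →L[ℂ] E} {M h : ℝ}
    (hh : 0 ≤ h) (hM : ∀ σ ∈ Icc 0 h, ‖S σ‖ ≤ M) (y : E) :
    ‖∫ σ in (0 : ℝ)..h, S σ y‖ ≤ M * ‖y‖ * h := by
  have := intervalIntegral.norm_integral_le_of_norm_le_const (a := 0) (b := h)
    (f := fun σ => S σ y) (C := M * ‖y‖) fun σ hσ => by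
      rw [uIoc_of_le hh] at hσ
      exact (S σ).le_of_opNorm_le (hM σ ⟨hσ.1.le, hσ.2⟩) y
  rwa [sub_zero, abs_of_nonneg hh] at this

theorem IsGeneratorOf.isClosed [CompleteSpace E] {A : E →ₗ.[ℂ] E} {S : ℝ → E →L[ℂ] E}
    (hA : IsGeneratorOf A S) : A.IsClosed := by
  have e : (A.graph : Set (E × E)) =
      ⋂ h ∈ Ici (0 : ℝ), {q | q.1 - S h q.1 = ∫ σ in (0 : ℝ)..h, S σ q.2} := by
    ext ⟨x, y⟩
    simp only [SetLike.mem_coe, hA.mem_graph_iff, mem_iInter, mem_ofPred_eq, mem_Ici]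
  rw [LinearPMap.IsClosed, e]
  refine isClosed_biInter fun h hh => isClosed_eq (by fun_prop) ?_
  obtain ⟨M, hM0, hM⟩ := hA.1.exists_bound h
  have hlip : LipschitzWith (M * h).toNNReal (fun y : E => ∫ σ in (0 : ℝ)..h, S σ y) := by
    refine LipschitzWith.of_dist_le_mul fun y z => ?_
    rw [dist_eq_norm, dist_eq_norm, ← intervalIntegral.integral_sub
      (hA.1.intervalIntegrable y le_rfl hh) (hA.1.intervalIntegrable z le_rfl hh)]
    simp only [← map_sub]
    rw [Real.coe_toNNReal _ (mul_nonneg hM0 hh)]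
    exact (IsC0Semigroup.norm_integral_le hh hM _).trans_eq (by ring)
  exact hlip.continuous.comp continuous_snd

/-- The averages $h^{-1}\int_0^h S(\sigma)x\,d\sigma$ lie in the domain and tend to $x$. -/
theorem IsGeneratorOf.dense_domain [CompleteSpace E] {A : E →ₗ.[ℂ] E} {S : ℝ → E →L[ℂ] E}
    (hA : IsGeneratorOf A S) : Dense (A.domain : Set E) := by
  intro x
  refine mem_closure_of_tendsto (hA.1.tendsto_average x) ?_
  filter_upwards [self_mem_nhdsWithin] with h hh
  have hh : (0 : ℝ) < h := hh
  have hmem : (∫ σ in (0 : ℝ)..h, S σ x, x - S h x) ∈ A.graph := by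
    rw [hA.mem_graph_iff]
    intro k hk
    have I := fun {a b : ℝ} (ha : 0 ≤ a) (hb : 0 ≤ b) => hA.1.intervalIntegrable x ha hb
    have e1 : S k (∫ σ in (0 : ℝ)..h, S σ x) = ∫ σ in k..(k + h), S σ x := by
      rw [← ContinuousLinearMap.intervalIntegral_comp_comm _ (I le_rfl hh.le)]
      have : ∫ σ in (0 : ℝ)..h, S k (S σ x) = ∫ σ in (0 : ℝ)..h, S (k + σ) x := by
        refine intervalIntegral.integral_congr fun σ hσ => ?_
        rw [uIcc_of_le hh.le] at hσ
        simp only [hA.1.add k σ hk hσ.1]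
        rfl
      rw [this, intervalIntegral.integral_comp_add_left (fun σ => S σ x), add_zero]
    have e2 : ∫ σ in (0 : ℝ)..k, S σ (x - S h x) =
        (∫ σ in (0 : ℝ)..k, S σ x) - ∫ σ in h..(k + h), S σ x := by
      have : ∫ σ in (0 : ℝ)..k, S σ (S h x) = ∫ σ in h..(k + h), S σ x := by
        have : ∫ σ in (0 : ℝ)..k, S σ (S h x) = ∫ σ in (0 : ℝ)..k, S (σ + h) x := by
          refine intervalIntegral.integral_congr fun σ hσ => ?_
          rw [uIcc_of_le hk] at hσ
          simp only [hA.1.add σ h hσ.1 hh.le]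
          rfl
        rw [this, intervalIntegral.integral_comp_add_right (fun σ => S σ x), zero_add]
      simp only [map_sub]
      rw [intervalIntegral.integral_sub (I le_rfl hk) (hA.1.intervalIntegrable _ le_rfl hk), this]
    have hkh : 0 ≤ k + h := by positivity
    -- Split $\int_0^h$ at $k$ and $\int_k^{k+h}$ at $h$; the oriented integral $\int_k^h$ cancels,
    -- whatever the order of $h$ and $k$.
    rw [e1, e2, ← intervalIntegral.integral_add_adjacent_intervals (I le_rfl hk) (I hk hh.le),
      ← intervalIntegral.integral_add_adjacent_intervals (I hk hh.le) (I hh.le hkh)]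
    abel
  have := A.domain.smul_mem ((h⁻¹ : ℝ) : ℂ) (LinearPMap.mem_domain_of_mem_graph hmem)
  rwa [Complex.coe_smul] at this

theorem IsGeneratorOf.semigroup_eq_of_le [CompleteSpace E] {A A' : E →ₗ.[ℂ] E}
    {S S' : ℝ → E →L[ℂ] E} (hA : IsGeneratorOf A S) (hA' : IsGeneratorOf A' S') (hle : A ≤ A')
    {τ : ℝ} (hτ : 0 ≤ τ) : S τ = S' τ := by
  refine ContinuousLinearMap.coeFn_injective
    ((S τ).continuous.ext_on hA.dense_domain (S' τ).continuous fun x hx => ?_)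
  have hxy := A.mem_graph ⟨x, hx⟩
  have := hA'.eq_orbit (w := fun σ => S σ x) (w' := fun σ => S σ (A ⟨x, hx⟩)) hτ
    ((hA.1.continuousOn x).mono Icc_subset_Ici_self)
    (fun σ hσ => LinearPMap.le_graph_of_le hle (hA.mem_orbit hxy hσ.1))
    fun σ hσ => hA.hasDerivWithinAt hxy hσ.1
  simpa [hA.1.zero] using this

theorem IsGeneratorOf.eq_of_le [CompleteSpace E] {A A' : E →ₗ.[ℂ] E}
    {S S' : ℝ → E →L[ℂ] E} (hA : IsGeneratorOf A S) (hA' : IsGeneratorOf A' S') (hle : A ≤ A') :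
    A = A' := by
  refine LinearPMap.eq_of_eq_graph (Submodule.ext fun ⟨x, y⟩ => ?_)
  rw [hA.2, hA'.2]
  refine tendsto_congr' ?_
  filter_upwards [self_mem_nhdsWithin] with h hh
  have hh : (0 : ℝ) < h := hh
  rw [hA.semigroup_eq_of_le hA' hle hh.le]

end Semigroups

end EvolCauchy

namespace EvolCauchy

/-! ### Semigroups of evolution generators act by weighted shifts -/

/-- Continuous functions decrease to indicators of closed sets, and finite Borel measures are inner
regular for closed sets. -/
theorem measure_le_of_forall_lintegral_le {Ω : Type*} [TopologicalSpace Ω]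
    [TopologicalSpace.PseudoMetrizableSpace Ω] [MeasurableSpace Ω] [BorelSpace Ω]
    {ν₁ ν₂ : Measure Ω} [IsFiniteMeasure ν₁] [IsFiniteMeasure ν₂]
    (h : ∀ ψ : BoundedContinuousFunction Ω NNReal, ∫⁻ x, ψ x ∂ν₁ ≤ ∫⁻ x, ψ x ∂ν₂) : ν₁ ≤ ν₂ := by
  let := TopologicalSpace.pseudoMetrizableSpacePseudoMetric Ω
  have hclosed : ∀ F : Set Ω, IsClosed F → ν₁ F ≤ ν₂ F := fun F hF =>
    le_of_tendsto_of_tendsto' (HasOuterApproxClosed.tendsto_lintegral_apprSeq hF ν₁)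
      (HasOuterApproxClosed.tendsto_lintegral_apprSeq hF ν₂) fun n => h _
  refine Measure.le_iff.2 fun s hs => ?_
  rw [hs.measure_eq_iSup_isClosed_of_ne_top (measure_ne_top _ _)]
  exact iSup_le fun F => iSup₂_le fun hFs hF => (hclosed F hF).trans (measure_mono hFs)

theorem ae_intervalMeasure_comp_sub {T τ : ℝ} (hτ : 0 ≤ τ) {P : ℝ → Prop}
    (h : ∀ᵐ t ∂(intervalMeasure T), P t) :
    ∀ᵐ t ∂(intervalMeasure T), τ ≤ t → P (t - τ) := by
  rw [ae_restrict_iff' measurableSet_Icc] at h ⊢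
  filter_upwards [(measurePreserving_sub_right volume τ).quasiMeasurePreserving.ae h] with t ht h1 h2
  exact ht ⟨sub_nonneg.2 h2, (sub_le_self t hτ).trans h1.2⟩

variable {X : Type*} [NormedAddCommGroup X] [NormedSpace ℂ X]

/-! ### The commutator with multiplication by $t$ -/

section Coordinate

theorem memLp_top_of_continuous {T : ℝ} {φ : ℝ → ℂ} (hφ : Continuous φ) :
    MemLp φ ∞ (intervalMeasure T) := by
  obtain ⟨C, hC⟩ := isCompact_Icc.exists_bound_of_continuousOn (hφ.continuousOn (s := Icc 0 T))
  exact memLp_top_of_bound hφ.aestronglyMeasurable C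
    ((ae_restrict_mem measurableSet_Icc).mono fun t ht => hC t ht)

/-- The class in `L^∞([0,T])` of a continuous function. -/
noncomputable def contLp (T : ℝ) (φ : ℝ → ℂ) (hφ : Continuous φ) : LpI T ∞ ℂ :=
  (memLp_top_of_continuous hφ).toLp φ

theorem coeFn_contLp {T : ℝ} {φ : ℝ → ℂ} (hφ : Continuous φ) :
    contLp T φ hφ =ᵐ[intervalMeasure T] φ := MemLp.coeFn_toLp _

theorem hasWeakDeriv_contLp {T : ℝ} (hT : 0 ≤ T) {φ φ' : ℝ → ℂ} (hφ : Continuous φ)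
    (hφ' : Continuous φ') (hd : ∀ t, HasDerivAt φ (φ' t) t) :
    HasWeakDeriv T (contLp T φ hφ) (contLp T φ' hφ') := by
  intro η hη hc hs
  have hη' : Continuous (deriv η) := hη.continuous_deriv (by simp)
  have e1 : ∫ t, deriv η t • contLp T φ hφ t ∂(intervalMeasure T)
      = ∫ t in (0 : ℝ)..T, deriv η t • φ t := by
    rw [intervalIntegral.integral_of_le hT, ← integral_Icc_eq_integral_Ioc]
    exact integral_congr_ae ((coeFn_contLp hφ).mono fun t ht => by simp only [ht])
  have e2 : ∫ t, η t • contLp T φ' hφ' t ∂(intervalMeasure T)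
      = ∫ t in (0 : ℝ)..T, η t • φ' t := by
    rw [intervalIntegral.integral_of_le hT, ← integral_Icc_eq_integral_Ioc]
    exact integral_congr_ae ((coeFn_contLp hφ').mono fun t ht => by simp only [ht])
  have h0 : η 0 = 0 := image_eq_zero_of_notMem_tsupport fun h => lt_irrefl _ (hs h).1
  have h1 : η T = 0 := image_eq_zero_of_notMem_tsupport fun h => lt_irrefl _ (hs h).2
  have i1 : IntervalIntegrable (fun t => deriv η t • φ t) volume 0 T :=
    (hη'.smul hφ).intervalIntegrable _ _
  have i2 : IntervalIntegrable (fun t => η t • φ' t) volume 0 T :=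
    (hη.continuous.smul hφ').intervalIntegrable _ _
  have := intervalIntegral.integral_eq_sub_of_hasDerivAt (a := 0) (b := T)
    (f := fun t => η t • φ t) (f' := fun t => η t • φ' t + deriv η t • φ t)
    (fun t _ => ((hη.differentiable (by simp)) t).hasDerivAt.smul (hd t)) (i2.add i1)
  rw [intervalIntegral.integral_add i2 i1, h0, h1, zero_smul, zero_smul, sub_zero] at this
  rw [e1, e2]
  exact eq_neg_of_add_eq_zero_right this

/-- Multiplication by the coordinate function `t` in `L^p([0,T], X)`. -/
noncomputable def mulCoord {T : ℝ} {p : ℝ≥0∞} [Fact (1 ≤ p)] : LpI T p X →L[ℂ] LpI T p X :=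
  mulScalar (contLp T (fun t => (t : ℂ)) Complex.continuous_ofReal)

theorem coeFn_mulCoord {T : ℝ} {p : ℝ≥0∞} [Fact (1 ≤ p)] (f : LpI T p X) :
    mulCoord f =ᵐ[intervalMeasure T] fun t => t • f t := by
  filter_upwards [coeFn_mulScalar (contLp T (fun t => (t : ℂ)) Complex.continuous_ofReal) f,
    coeFn_contLp (T := T) Complex.continuous_ofReal] with t h1 h2
  rw [mulCoord, h1, h2, Complex.coe_smul]

theorem mulScalar_one {T : ℝ} {p : ℝ≥0∞} [Fact (1 ≤ p)] (f : LpI T p X) :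
    mulScalar (contLp T (fun _ => 1) continuous_const) f = f := by
  refine Lp.ext ?_
  filter_upwards [coeFn_mulScalar (contLp T (fun _ => 1) continuous_const) f,
    coeFn_contLp (T := T) (φ := fun _ => 1) continuous_const] with t h1 h2
  rw [h1, h2, one_smul]

/-- The commutator relation `K t - t K = 1` on the domain of `K`. -/
def HasCoordCommutator {T : ℝ} {p : ℝ≥0∞} [Fact (1 ≤ p)]
    (K : LpI T p X →ₗ.[ℂ] LpI T p X) : Prop :=
  ∀ ⦃f g : LpI T p X⦄, (f, g) ∈ K.graph → (mulCoord f, mulCoord g + f) ∈ K.graph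

/-- Phrased through the graph, the commutator relation is preserved by limits and needs no separate
domain condition. -/
theorem IsEvolutionPreGenerator.mulScalar_mem_graph {T : ℝ} {p : ℝ≥0∞}
    [Fact (1 ≤ p)] {K : LpI T p X →ₗ.[ℂ] LpI T p X} (hK : IsEvolutionPreGenerator K)
    {φ φ' : LpI T ∞ ℂ} (hw : HasWeakDeriv T φ φ') {f g : LpI T p X} (h : (f, g) ∈ K.graph) :
    (mulScalar φ f, mulScalar φ g + mulScalar φ' f) ∈ K.graph := by
  obtain ⟨y, rfl, rfl⟩ := (LinearPMap.mem_graph_iff K).1 h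
  rw [← sub_eq_iff_eq_add'.1 (hK.commutator _ _ hw y)]
  exact K.mem_graph ⟨_, hK.mul_mem _ _ hw y y.2⟩

/-- This is the case $\varphi(t)=t$, $\varphi'=1$. Only the graph relation is assumed, so that it
applies to a closure not yet known to be a pre-generator. -/
theorem hasCoordCommutator_of_forall {T : ℝ} (hT : 0 ≤ T) {p : ℝ≥0∞} [Fact (1 ≤ p)]
    {K : LpI T p X →ₗ.[ℂ] LpI T p X}
    (hK : ∀ {φ φ' : LpI T ∞ ℂ}, HasWeakDeriv T φ φ' → ∀ {f g : LpI T p X}, (f, g) ∈ K.graph →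
      (mulScalar φ f, mulScalar φ g + mulScalar φ' f) ∈ K.graph) : HasCoordCommutator K := by
  intro f g h
  have := hK (hasWeakDeriv_contLp hT Complex.continuous_ofReal (φ' := fun _ => 1) continuous_const
    fun t => Complex.ofRealCLM.hasDerivAt) h
  rwa [mulScalar_one] at this

theorem IsEvolutionPreGenerator.hasCoordCommutator {T : ℝ} (hT : 0 ≤ T) {p : ℝ≥0∞}
    [Fact (1 ≤ p)] {K : LpI T p X →ₗ.[ℂ] LpI T p X} (hK : IsEvolutionPreGenerator K) :
    HasCoordCommutator K :=
  hasCoordCommutator_of_forall hT fun hw _ _ h => hK.mulScalar_mem_graph hw h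

end Coordinate

/-! ### From the commutator to a pointwise shift estimate -/

section Localization

variable [CompleteSpace X] {T : ℝ} {p : ℝ≥0∞} [Fact (1 ≤ p)]
  {K : LpI T p X →ₗ.[ℂ] LpI T p X} {S : ℝ → LpI T p X →L[ℂ] LpI T p X}

/-- For $f$ in the domain, $w(\sigma)=(t-\sigma)S(\sigma)f$ solves $w'=-Kw$ with $w(0)=tf$: the
extra term $S(\sigma)f$ in $Kw$ matches the derivative of $-\sigma$. Density does the rest. -/
theorem semigroup_mulCoord (hK : HasCoordCommutator K) (hS : IsGeneratorOf K S)
    {τ : ℝ} (hτ : 0 ≤ τ) (f : LpI T p X) :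
    S τ (mulCoord f) = mulCoord (S τ f) - τ • S τ f := by
  have hc : Continuous fun f : LpI T p X => mulCoord (S τ f) - τ • S τ f := by fun_prop
  refine congrFun (((S τ).continuous.comp mulCoord.continuous).ext_on hS.dense_domain hc
    fun f hf => ?_) f
  have hfg := K.mem_graph ⟨f, hf⟩
  set g := K ⟨f, hf⟩
  have := hS.eq_orbit (w := fun σ => mulCoord (S σ f) - σ • S σ f)
    (w' := fun σ => (mulCoord (S σ g) + S σ f) - σ • S σ g) hτ ?_ ?_ ?_
  · simpa [hS.1.zero] using this.symm
  · have h1 : ContinuousOn (fun σ => S σ f) (Icc 0 τ) :=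
      (hS.1.continuousOn f).mono Icc_subset_Ici_self
    exact (mulCoord.continuous.comp_continuousOn h1).sub (continuousOn_id.smul h1)
  · intro σ hσ
    have h1 := hS.mem_orbit hfg hσ.1
    have h2 := K.graph.smul_mem (σ : ℂ) h1
    have := K.graph.sub_mem (hK h1) h2
    exact this
  · intro σ hσ
    have h1 := hS.hasDerivWithinAt hfg hσ.1
    have h2 := ((mulCoord (X := X) (T := T) (p := p)).restrictScalars ℝ).hasFDerivAt.comp_hasDerivWithinAt
      σ h1
    have h3 := (hasDerivWithinAt_id σ (Ici σ)).smul h1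
    refine (h2.sub h3).congr_deriv ?_
    simp
    abel

theorem exists_mul_polynomial (hK : HasCoordCommutator K)
    (hS : IsGeneratorOf K S) {τ : ℝ} (hτ : 0 ≤ τ) (P : Polynomial ℝ) (f : LpI T p X) :
    ∃ h : LpI T p X, h =ᵐ[intervalMeasure T] (fun t => P.eval t • f t) ∧
      S τ h =ᵐ[intervalMeasure T] fun t => P.eval (t - τ) • S τ f t := by
  induction P using Polynomial.induction_on with
  | C a =>
    refine ⟨a • f, ?_, ?_⟩
    · exact (Lp.coeFn_smul a f).mono fun t ht => by simpa using ht
    · rw [ContinuousLinearMap.map_smul_of_tower]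
      exact (Lp.coeFn_smul a (S τ f)).mono fun t ht => by simpa using ht
  | add P Q hP hQ =>
    obtain ⟨h, h1, h2⟩ := hP
    obtain ⟨k, k1, k2⟩ := hQ
    refine ⟨h + k, ?_, ?_⟩
    · filter_upwards [h1, k1, Lp.coeFn_add h k] with t a b c
      rw [c, Pi.add_apply, a, b, Polynomial.eval_add, add_smul]
    · rw [map_add]
      filter_upwards [h2, k2, Lp.coeFn_add (S τ h) (S τ k)] with t a b c
      rw [c, Pi.add_apply, a, b, Polynomial.eval_add, add_smul]
  | monomial n a ih =>
    obtain ⟨h, h1, h2⟩ := ih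
    refine ⟨mulCoord h, ?_, ?_⟩
    · filter_upwards [h1, coeFn_mulCoord h] with t a b
      rw [b, a, smul_smul]
      simp
      ring_nf
    · rw [semigroup_mulCoord hK hS hτ]
      filter_upwards [h2, coeFn_mulCoord (S τ h), Lp.coeFn_smul τ (S τ h),
        Lp.coeFn_sub (mulCoord (S τ h)) (τ • S τ h)] with t a b c d
      rw [d, Pi.sub_apply, c, b, Pi.smul_apply, a, ← sub_smul, smul_smul]
      simp
      ring_nf

omit [CompleteSpace X] in
theorem eLpNorm_smul_le_of_forall_le {φ : ℝ → ℝ} {f : LpI T p X} {ε : ℝ}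
    (h : ∀ t ∈ Icc 0 T, |φ t| ≤ ε) :
    eLpNorm (fun t => φ t • f t) p (intervalMeasure T) ≤ ENNReal.ofReal ε * ‖f‖ₑ := by
  rw [Lp.enorm_def]
  refine eLpNorm_le_mul_eLpNorm_of_ae_le_mul ?_ p
  filter_upwards [ae_restrict_mem measurableSet_Icc] with t ht
  rw [norm_smul]
  exact mul_le_mul_of_nonneg_right (h t ht) (norm_nonneg _)

/-- The intertwining relation for polynomials gives this bound exactly; uniform approximation
carries the inequality to continuous `φ`. -/
theorem eLpNorm_mul_semigroup_le (hK : HasCoordCommutator K)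
    (hS : IsGeneratorOf K S) {τ : ℝ} (hτ : 0 ≤ τ) {φ : ℝ → ℝ} (hφ : Continuous φ)
    (f : LpI T p X) :
    eLpNorm (fun t => φ (t - τ) • S τ f t) p (intervalMeasure T) ≤
      ‖S τ‖ₑ * eLpNorm (fun t => φ t • f t) p (intervalMeasure T) := by
  set a := eLpNorm (fun t => φ t • f t) p (intervalMeasure T)
  have hp : 1 ≤ p := Fact.out
  have key : ∀ ε : ℝ, 0 < ε → eLpNorm (fun t => φ (t - τ) • S τ f t) p (intervalMeasure T) ≤
      ‖S τ‖ₑ * (a + ENNReal.ofReal ε * ‖f‖ₑ) + ENNReal.ofReal ε * ‖S τ f‖ₑ := by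
    intro ε hε
    -- The interval $[-\tau,T]$ contains both $t$ and $t-\tau$ for every $t\in[0,T]$.
    obtain ⟨P, hP⟩ := exists_polynomial_near_of_continuousOn (-τ) T φ hφ.continuousOn ε hε
    obtain ⟨h, h1, h2⟩ := exists_mul_polynomial hK hS hτ P f
    have hm : ∀ (ψ : ℝ → ℝ) (k : LpI T p X), Continuous ψ →
        AEStronglyMeasurable (fun t => ψ t • k t) (intervalMeasure T) := fun ψ k hψ =>
      hψ.aestronglyMeasurable.smul (Lp.aestronglyMeasurable k)
    have b1 : eLpNorm (fun t => (φ (t - τ) - P.eval (t - τ)) • S τ f t) p (intervalMeasure T) ≤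
        ENNReal.ofReal ε * ‖S τ f‖ₑ :=
      eLpNorm_smul_le_of_forall_le (φ := fun t => φ (t - τ) - P.eval (t - τ)) fun t ht => by
        rw [abs_sub_comm]
        exact (hP _ ⟨by linarith [ht.1], by linarith [ht.2]⟩).le
    have b2 : eLpNorm (fun t => (P.eval t - φ t) • f t) p (intervalMeasure T) ≤
        ENNReal.ofReal ε * ‖f‖ₑ :=
      eLpNorm_smul_le_of_forall_le (φ := fun t => P.eval t - φ t) fun t ht =>
        (hP _ ⟨by linarith [ht.1], ht.2⟩).le
    have b3 : ‖h‖ₑ ≤ a + ENNReal.ofReal ε * ‖f‖ₑ := by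
      rw [Lp.enorm_def, eLpNorm_congr_ae h1]
      refine (eLpNorm_congr_ae (Eventually.of_forall fun t => ?_)).trans_le
        ((eLpNorm_add_le (hm _ f hφ) (hm _ f (P.continuous.sub hφ)) hp).trans
          (add_le_add_right b2 _))
      simp [sub_smul]
    have b4 : ‖S τ h‖ₑ ≤ ‖S τ‖ₑ * ‖h‖ₑ := (S τ).le_opENorm h
    have hs : Continuous fun t : ℝ => t - τ := by fun_prop
    have b5 := eLpNorm_add_le (hm _ (S τ f) (P.continuous.comp hs))
      (hm _ (S τ f) ((hφ.comp hs).sub (P.continuous.comp hs))) hp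
    rw [eLpNorm_congr_ae (g := fun t => φ (t - τ) • S τ f t) (Eventually.of_forall fun t => by
      simp [sub_smul])] at b5
    refine b5.trans (add_le_add ?_ b1)
    have : eLpNorm (fun t => P.eval (t - τ) • S τ f t) p (intervalMeasure T) = ‖S τ h‖ₑ := by
      rw [Lp.enorm_def, eLpNorm_congr_ae h2]
    exact this.le.trans (b4.trans (mul_le_mul_right b3 _))
  have lim : Tendsto (fun ε : ℝ => ‖S τ‖ₑ * (a + ENNReal.ofReal ε * ‖f‖ₑ) +
      ENNReal.ofReal ε * ‖S τ f‖ₑ) (𝓝[>] 0) (𝓝 (‖S τ‖ₑ * (a + 0 * ‖f‖ₑ) + 0 * ‖S τ f‖ₑ)) := by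
    have h0 : Tendsto ENNReal.ofReal (𝓝[>] 0) (𝓝 0) := by
      have := ENNReal.continuous_ofReal.tendsto 0
      rw [ENNReal.ofReal_zero] at this
      exact this.mono_left nhdsWithin_le_nhds
    refine (ENNReal.Tendsto.const_mul (tendsto_const_nhds.add
      (ENNReal.Tendsto.mul_const h0 (Or.inr enorm_ne_top))) (Or.inr enorm_ne_top)).add
      (ENNReal.Tendsto.mul_const h0 (Or.inr enorm_ne_top))
  rw [zero_mul, zero_mul, add_zero, add_zero] at lim
  refine ge_of_tendsto lim ?_
  filter_upwards [self_mem_nhdsWithin] with ε hε using key ε hε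

/-- Apply the norm bound with $\varphi=\psi^{1/p}$ and raise it to the power $p$; finiteness of $p$
enters here. -/
theorem lintegral_mul_semigroup_le (hp : p ≠ ⊤) (hK : HasCoordCommutator K)
    (hS : IsGeneratorOf K S) {τ : ℝ} (hτ : 0 ≤ τ) (f : LpI T p X)
    (ψ : BoundedContinuousFunction ℝ NNReal) :
    ∫⁻ t, ψ (t - τ) * ‖S τ f t‖ₑ ^ p.toReal ∂(intervalMeasure T) ≤
      ‖S τ‖ₑ ^ p.toReal * ∫⁻ t, ψ t * ‖f t‖ₑ ^ p.toReal ∂(intervalMeasure T) := by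
  have hp1 : 1 ≤ p := Fact.out
  have hp0 : p ≠ 0 := (zero_lt_one.trans_le hp1).ne'
  have hq : 0 < p.toReal := ENNReal.toReal_pos hp0 hp
  have hφ : Continuous fun t => (ψ t : ℝ) ^ p.toReal⁻¹ :=
    (NNReal.continuous_coe.comp ψ.continuous).rpow_const fun _ => Or.inr (by positivity)
  have key := eLpNorm_mul_semigroup_le hK hS hτ hφ f
  have e : ∀ (t : ℝ) (x : X), ‖(ψ t : ℝ) ^ p.toReal⁻¹ • x‖ₑ ^ p.toReal = ψ t * ‖x‖ₑ ^ p.toReal := by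
    intro t x
    rw [enorm_smul, ENNReal.mul_rpow_of_nonneg _ _ hq.le, Real.enorm_eq_ofReal (by positivity),
      ENNReal.ofReal_rpow_of_nonneg (by positivity) hq.le, ← Real.rpow_mul (by positivity),
      inv_mul_cancel₀ hq.ne', Real.rpow_one, ENNReal.ofReal_coe_nnreal]
  have key' := ENNReal.rpow_le_rpow key hq.le
  rw [ENNReal.mul_rpow_of_nonneg _ _ hq.le, eLpNorm_eq_lintegral_rpow_enorm_toReal hp0 hp,
    eLpNorm_eq_lintegral_rpow_enorm_toReal hp0 hp, ← ENNReal.rpow_mul, ← ENNReal.rpow_mul,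
    one_div, inv_mul_cancel₀ hq.ne', ENNReal.rpow_one, ENNReal.rpow_one] at key'
  simpa only [e] using key'

/-- Bounds against test functions `ψ` compare the measure $\|S(\tau)f\|^p\,dt$, translated by
$-\tau$, with a multiple of $\|f\|^p\,dt$. -/
theorem setLIntegral_semigroup_le (hp : p ≠ ⊤) (hK : HasCoordCommutator K)
    (hS : IsGeneratorOf K S) {τ : ℝ} (hτ : 0 ≤ τ) (f : LpI T p X) {s : Set ℝ}
    (hs : MeasurableSet s) :
    ∫⁻ t in (fun t => t - τ) ⁻¹' s, ‖S τ f t‖ₑ ^ p.toReal ∂(intervalMeasure T) ≤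
      ‖S τ‖ₑ ^ p.toReal * ∫⁻ t in s, ‖f t‖ₑ ^ p.toReal ∂(intervalMeasure T) := by
  have hp1 : 1 ≤ p := Fact.out
  have hp0 : p ≠ 0 := (zero_lt_one.trans_le hp1).ne'
  have hm : ∀ k : LpI T p X, Measurable fun t => ‖k t‖ₑ ^ p.toReal := fun k =>
    (Lp.stronglyMeasurable k).enorm.pow_const _
  have hfin : ∀ k : LpI T p X,
      IsFiniteMeasure ((intervalMeasure T).withDensity fun t => ‖k t‖ₑ ^ p.toReal) := fun k =>
    isFiniteMeasure_withDensity
      (lintegral_rpow_enorm_lt_top_of_eLpNorm_lt_top hp0 hp (Lp.eLpNorm_lt_top k)).ne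
  have hτm : Measurable fun t : ℝ => t - τ := measurable_id.sub_const τ
  have hc : ‖S τ‖ₑ ^ p.toReal ≠ ⊤ := ENNReal.rpow_ne_top_of_nonneg ENNReal.toReal_nonneg enorm_ne_top
  have := hfin f
  have := hfin (S τ f)
  have : IsFiniteMeasure
      (‖S τ‖ₑ ^ p.toReal • (intervalMeasure T).withDensity fun t => ‖f t‖ₑ ^ p.toReal) :=
    Measure.smul_finite _ hc
  have := measure_le_of_forall_lintegral_le
    (ν₁ := ((intervalMeasure T).withDensity fun t => ‖S τ f t‖ₑ ^ p.toReal).map fun t => t - τ)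
    (ν₂ := ‖S τ‖ₑ ^ p.toReal • (intervalMeasure T).withDensity fun t => ‖f t‖ₑ ^ p.toReal)
    (fun ψ => by
      have hψ : Measurable fun t => (ψ t : ℝ≥0∞) :=
        measurable_coe_nnreal_ennreal.comp ψ.continuous.measurable
      rw [lintegral_map hψ hτm, lintegral_smul_measure,
        lintegral_withDensity_eq_lintegral_mul _ (hm _) hψ]
      refine (lintegral_withDensity_eq_lintegral_mul _ (hm _) (hψ.comp hτm)).trans_le ?_
      simpa only [Pi.mul_apply, mul_comm, smul_eq_mul, Function.comp_apply] using
        lintegral_mul_semigroup_le hp hK hS hτ f ψ) s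
  rwa [Measure.map_apply hτm hs, withDensity_apply _ (hτm hs), Measure.smul_apply,
    withDensity_apply _ hs, smul_eq_mul] at this

/-- The semigroup shifts to the right, with pointwise norm control. -/
theorem ae_norm_semigroup_le (hp : p ≠ ⊤) (hK : HasCoordCommutator K)
    (hS : IsGeneratorOf K S) {τ : ℝ} (hτ : 0 ≤ τ) (f : LpI T p X) :
    ∀ᵐ t ∂(intervalMeasure T),
      (τ ≤ t → ‖S τ f t‖ ≤ ‖S τ‖ * ‖f (t - τ)‖) ∧ (t < τ → S τ f t = 0) := by
  have hp1 : 1 ≤ p := Fact.out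
  have hp0 : p ≠ 0 := (zero_lt_one.trans_le hp1).ne'
  have hq : 0 < p.toReal := ENNReal.toReal_pos hp0 hp
  have hm : ∀ k : LpI T p X, Measurable fun t => ‖k t‖ₑ ^ p.toReal := fun k =>
    (Lp.stronglyMeasurable k).enorm.pow_const _
  -- Extension by zero puts both claims into one inequality on $\mathbb R$: $H(t-\tau)$ vanishes for
  -- $t<\tau$.
  set H : ℝ → ℝ≥0∞ := (Icc 0 T).indicator fun t => ‖S τ‖ₑ ^ p.toReal * ‖f t‖ₑ ^ p.toReal
  have hH : Measurable H := ((hm f).const_mul _).indicator measurableSet_Icc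
  have key : (Icc 0 T).indicator (fun t => ‖S τ f t‖ₑ ^ p.toReal) ≤ᵐ[volume]
      fun t => H (t - τ) := by
    refine ae_le_of_forall_setLIntegral_le_of_sigmaFinite ((hm _).indicator measurableSet_Icc)
      fun B hB _ => ?_
    have hB' : MeasurableSet ((fun t => t + τ) ⁻¹' B) := measurable_id.add_const τ hB
    have h1 := setLIntegral_semigroup_le hp hK hS hτ f hB'
    have e : (fun t => t - τ) ⁻¹' ((fun t => t + τ) ⁻¹' B) = B := by
      ext t
      simp
    rw [e, ← lintegral_const_mul _ (hm f)] at h1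
    have h2 : ∫⁻ t in (fun t => t + τ) ⁻¹' B, H t = ∫⁻ t in B, H (t - τ) := by
      have := (measurePreserving_add_right volume τ).setLIntegral_comp_preimage hB
        (f := fun t => H (t - τ)) (hH.comp (measurable_id.sub_const τ))
      simpa using this
    rw [← h2, setLIntegral_indicator measurableSet_Icc, setLIntegral_indicator measurableSet_Icc]
    rwa [Measure.restrict_restrict hB, Measure.restrict_restrict hB',
      inter_comm, inter_comm _ (Icc 0 T)] at h1
  rw [ae_restrict_iff' measurableSet_Icc]
  filter_upwards [key] with t ht htI
  rw [indicator_of_mem htI] at ht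
  constructor
  · intro h
    have hmem : t - τ ∈ Icc 0 T := ⟨sub_nonneg.2 h, (sub_le_self t hτ).trans htI.2⟩
    simp only [H] at ht
    rw [indicator_of_mem hmem, ← ENNReal.mul_rpow_of_nonneg _ _ hq.le,
      ENNReal.rpow_le_rpow_iff hq, ← ofReal_norm, ← ofReal_norm, ← ofReal_norm,
      ← ENNReal.ofReal_mul (norm_nonneg _), ENNReal.ofReal_le_ofReal_iff (by positivity)] at ht
    exact ht
  · intro h
    have hmem : t - τ ∉ Icc 0 T := fun h' => absurd (sub_nonneg.1 h'.1) (not_le.2 h)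
    simp only [H] at ht
    rw [indicator_of_notMem hmem, nonpos_iff_eq_zero, ENNReal.rpow_eq_zero_iff_of_pos hq,
      enorm_eq_zero] at ht
    exact ht

theorem semigroup_eq_zero (hT : 0 ≤ T) (hp : p ≠ ⊤) (hK : HasCoordCommutator K)
    (hS : IsGeneratorOf K S) {τ : ℝ} (hτ : T ≤ τ) : S τ = 0 := by
  refine ContinuousLinearMap.ext fun f => Lp.ext ?_
  -- When $\tau=T$ the point $t=T$ is not below $\tau$; it is a null set.
  have hne : ∀ᵐ t ∂(intervalMeasure T), t ≠ T :=
    ae_restrict_of_ae (Measure.ae_ne volume T)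
  filter_upwards [ae_norm_semigroup_le hp hK hS (hT.trans hτ) f,
    ae_restrict_mem measurableSet_Icc, hne, Lp.coeFn_zero X p (intervalMeasure T)] with t h1 h2 h3 h4
  rw [h1.2 ((lt_of_le_of_ne h2.2 h3).trans_le hτ), zero_apply, h4]
  rfl

end Localization

end EvolCauchy

namespace EvolCauchy

variable {X : Type*} [NormedAddCommGroup X] [NormedSpace ℂ X]

/-! ### Elements of the domain are continuous functions -/

omit [NormedSpace ℂ X] in
theorem IsContRep.eqOn {T : ℝ} (hT : 0 < T) {f u v : ℝ → X} (hu : IsContRep T f u)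
    (hv : IsContRep T f v) : EqOn u v (Icc 0 T) :=
  Measure.eqOn_Icc_of_ae_eq volume hT.ne (hu.2.symm.trans hv.2) hu.1 hv.1

theorem le_of_ae_le_of_continuousOn {a b : ℝ} (hab : a < b) {u v : ℝ → ℝ}
    (hu : ContinuousOn u (Icc a b)) (hv : ContinuousOn v (Icc a b))
    (h : ∀ᵐ t ∂(volume.restrict (Icc a b)), u t ≤ v t) {t : ℝ} (ht : t ∈ Icc a b) : u t ≤ v t :=
  max_eq_right_iff.1 (Measure.eqOn_Icc_of_ae_eq volume hab.ne
    (f := fun t => max (u t) (v t)) (g := v) (h.mono fun _ => max_eq_right)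
    (hu.sup hv) hv ht)

/-- Restriction to `J`, seen as a bounded operator from `L^p` to `L^1`. -/
theorem exists_clm_enorm_eq_setLIntegral {T : ℝ} {p : ℝ≥0∞} [Fact (1 ≤ p)] {J : Set ℝ}
    (hJ : MeasurableSet J) : ∃ L : LpI T p X →L[ℂ] LpI T 1 X,
      ∀ f, ‖L f‖ₑ = ∫⁻ t in J, ‖f t‖ₑ ∂(intervalMeasure T) := by
  have h1 : ENNReal.HolderTriple p.conjExponent p 1 :=
    (ENNReal.HolderConjugate.conjExponent (p := p) Fact.out).symm
  have h2 : Fact (1 ≤ p.conjExponent) := ⟨by rw [ENNReal.conjExponent]; exact le_self_add⟩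
  -- The indicator lies in the dual exponent because the interval has finite measure; Hölder
  -- multiplication by it is the desired operator.
  let χ : LpI T p.conjExponent ℂ := indicatorConstLp _ hJ (measure_ne_top _ J) 1
  let L : LpI T p X →L[ℂ] LpI T 1 X := (ContinuousLinearMap.lsmul ℂ ℂ : ℂ →L[ℂ] X →L[ℂ] X).holderL
    (intervalMeasure T) p.conjExponent p 1 χ
  refine ⟨L, fun f => ?_⟩
  have hL : L f =ᵐ[intervalMeasure T] fun t => χ t • f t :=
    ContinuousLinearMap.coeFn_holder _ χ f
  have hχ : χ =ᵐ[intervalMeasure T] J.indicator fun _ => 1 := indicatorConstLp_coeFn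
  rw [Lp.enorm_def, eLpNorm_one_eq_lintegral_enorm, ← lintegral_indicator hJ]
  refine lintegral_congr_ae ?_
  filter_upwards [hL, hχ] with t h3 h4
  rw [h3, h4]
  by_cases h : t ∈ J <;> simp [h]

/-! ### The sup-norm bound on the domain -/

section Bound

variable [CompleteSpace X] {T : ℝ} {p : ℝ≥0∞} [Fact (1 ≤ p)]
  {K : LpI T p X →ₗ.[ℂ] LpI T p X} {S : ℝ → LpI T p X →L[ℂ] LpI T p X}

theorem setLIntegral_semigroup_one_le (hp : p ≠ ⊤) (hK : HasCoordCommutator K)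
    (hS : IsGeneratorOf K S) {τ M : ℝ} (hτ : 0 ≤ τ) (hM : ‖S τ‖ ≤ M)
    (g : LpI T p X) {J : Set ℝ} :
    ∫⁻ t in J, ‖S τ g t‖ₑ ∂(intervalMeasure T) ≤
      ∫⁻ t in J, ENNReal.ofReal M * (Icc 0 T).indicator (fun t => ‖g t‖ₑ) (t - τ)
        ∂(intervalMeasure T) := by
  refine lintegral_mono_ae (ae_restrict_of_ae ?_)
  filter_upwards [ae_norm_semigroup_le hp hK hS hτ g, ae_restrict_mem measurableSet_Icc]
    with t h1 h2
  rcases le_or_gt τ t with h | h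
  · have hmem : t - τ ∈ Icc 0 T := ⟨sub_nonneg.2 h, (sub_le_self t hτ).trans h2.2⟩
    rw [indicator_of_mem hmem, ← ofReal_norm,
      ← ofReal_norm, ← ENNReal.ofReal_mul ((norm_nonneg _).trans hM)]
    exact ENNReal.ofReal_le_ofReal
      ((h1.1 h).trans (mul_le_mul_of_nonneg_right hM (norm_nonneg _)))
  · simp [h1.2 h]

/-- Since $S(T)=0$, $f=\int_0^T S(\sigma)g\,d\sigma$. Mapping into $L^1(J)$ avoids evaluating this
$L^p$-valued integral pointwise; then the shift estimate and Tonelli apply. Arbitrary `J` later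
gives an a.e. bound. -/
theorem setLIntegral_le_of_mem_graph (hT : 0 ≤ T) (hp : p ≠ ⊤) (hK : HasCoordCommutator K)
    (hS : IsGeneratorOf K S) {M : ℝ} (hM : ∀ σ ∈ Icc 0 T, ‖S σ‖ ≤ M)
    {f g : LpI T p X} (hfg : (f, g) ∈ K.graph) {J : Set ℝ} (hJ : MeasurableSet J) :
    ∫⁻ t in J, ‖f t‖ₑ ∂(intervalMeasure T) ≤
      ∫⁻ _ in J, (ENNReal.ofReal M * ∫⁻ t, ‖g t‖ₑ ∂(intervalMeasure T)) ∂(intervalMeasure T) := by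
  obtain ⟨L, hL⟩ := exists_clm_enorm_eq_setLIntegral (X := X) (T := T) (p := p) hJ
  have hf := hS.sub_eq_integral hfg hT
  rw [semigroup_eq_zero hT hp hK hS le_rfl, zero_apply, sub_zero] at hf
  have hLf := (congrArg L hf).trans
    (L.intervalIntegral_comp_comm (hS.1.intervalIntegrable g le_rfl hT)).symm
  rw [intervalIntegral.integral_of_le hT] at hLf
  set G : ℝ → ℝ≥0∞ := (Icc 0 T).indicator fun t => ‖g t‖ₑ
  have hG : Measurable G := (Lp.stronglyMeasurable g).enorm.indicator measurableSet_Icc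
  have hG2 : Measurable fun z : ℝ × ℝ => ENNReal.ofReal M * G (z.2 - z.1) :=
    (hG.comp (measurable_snd.sub measurable_fst)).const_mul _
  calc ∫⁻ t in J, ‖f t‖ₑ ∂(intervalMeasure T) = ‖L f‖ₑ := (hL f).symm
    _ ≤ ∫⁻ σ in Ioc 0 T, ‖L (S σ g)‖ₑ := by
      rw [hLf]
      exact enorm_integral_le_lintegral_enorm _
    _ ≤ ∫⁻ σ in Ioc 0 T, ∫⁻ t in J, ENNReal.ofReal M * G (t - σ) ∂(intervalMeasure T) := by
      refine setLIntegral_mono' measurableSet_Ioc fun σ hσ => ?_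
      rw [hL]
      exact setLIntegral_semigroup_one_le hp hK hS hσ.1.le (hM σ ⟨hσ.1.le, hσ.2⟩) g
    _ = ∫⁻ t in J, (∫⁻ σ in Ioc 0 T, ENNReal.ofReal M * G (t - σ)) ∂(intervalMeasure T) :=
      lintegral_lintegral_swap hG2.aemeasurable
    _ ≤ _ := by
      refine lintegral_mono fun t => ?_
      have hGt : Measurable fun σ => G (t - σ) := hG.comp (measurable_const.sub measurable_id)
      rw [lintegral_const_mul _ hGt]
      refine mul_le_mul_right ((setLIntegral_le_lintegral _ _).trans ?_) _
      rw [lintegral_sub_left_eq_self, lintegral_indicator measurableSet_Icc]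

/-- The domain of `K` with the graph norm is continuously embedded in `L^∞`. -/
theorem exists_ae_norm_le_of_mem_graph (hT : 0 ≤ T) (hp : p ≠ ⊤) (hK : HasCoordCommutator K)
    (hS : IsGeneratorOf K S) : ∃ c : ℝ, 0 ≤ c ∧ ∀ f g : LpI T p X, (f, g) ∈ K.graph →
      ∀ᵐ t ∂(intervalMeasure T), ‖f t‖ ≤ c * ‖g‖ := by
  obtain ⟨M, hM0, hM⟩ := hS.1.exists_bound T
  obtain ⟨L, hL⟩ := exists_clm_enorm_eq_setLIntegral (X := X) (T := T) (p := p) MeasurableSet.univ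
  refine ⟨M * ‖L‖, by positivity, fun f g hfg => ?_⟩
  have h1 : (fun t => ‖f t‖ₑ) ≤ᵐ[intervalMeasure T]
      fun _ => ENNReal.ofReal M * ∫⁻ t, ‖g t‖ₑ ∂(intervalMeasure T) :=
    ae_le_of_forall_setLIntegral_le_of_sigmaFinite (Lp.stronglyMeasurable f).enorm
      fun J hJ _ => setLIntegral_le_of_mem_graph hT hp hK hS hM hfg hJ
  filter_upwards [h1] with t ht
  have h2 := hL g
  rw [Measure.restrict_univ] at h2
  rw [← h2, ← ofReal_norm, ← ofReal_norm, ← ENNReal.ofReal_mul hM0,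
    ENNReal.ofReal_le_ofReal_iff (by positivity)] at ht
  refine ht.trans ?_
  rw [mul_assoc]
  exact mul_le_mul_of_nonneg_left (L.le_opNorm g) hM0

end Bound

omit [NormedSpace ℂ X] in
-- The uniform limit is continuous, and an a.e. convergent subsequence identifies it with the $L^p$
-- limit.
theorem exists_isContRep_of_tendsto [CompleteSpace X] {T : ℝ} {p : ℝ≥0∞} [Fact (1 ≤ p)]
    {f : ℕ → LpI T p X} {f₀ : LpI T p X} {u : ℕ → ℝ → X} (hu : ∀ n, IsContRep T (f n) (u n))
    (hf : Tendsto f atTop (𝓝 f₀)) (hc : UniformCauchySeqOn u atTop (Icc 0 T)) :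
    ∃ v, IsContRep T f₀ v := by
  have hlim : ∀ t, ∃ x, t ∈ Icc 0 T → Tendsto (fun n => u n t) atTop (𝓝 x) := fun t => by
    by_cases ht : t ∈ Icc 0 T
    · obtain ⟨x, hx⟩ := cauchySeq_tendsto_of_complete (hc.cauchySeq ht)
      exact ⟨x, fun _ => hx⟩
    · exact ⟨0, fun h => absurd h ht⟩
  choose v hv using hlim
  refine ⟨v, (hc.tendstoUniformlyOn_of_tendsto hv).continuousOn
    (Eventually.of_forall fun n => (hu n).1).frequently, ?_⟩
  obtain ⟨ns, hns, hae⟩ := (tendstoInMeasure_of_tendsto_Lp hf).exists_seq_tendsto_ae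
  filter_upwards [hae, ae_all_iff.2 fun n => (hu n).2, ae_restrict_mem measurableSet_Icc]
    with t h1 h2 h3
  exact tendsto_nhds_unique (h1.congr fun n => h2 _) ((hv t h3).comp hns.tendsto_atTop)

theorem mulScalar_mem_graph_closure {T : ℝ} {p : ℝ≥0∞} [Fact (1 ≤ p)]
    {K : LpI T p X →ₗ.[ℂ] LpI T p X} (hK : IsEvolutionPreGenerator K) (hc : K.IsClosable)
    {φ φ' : LpI T ∞ ℂ} (hw : HasWeakDeriv T φ φ') {f g : LpI T p X}
    (h : (f, g) ∈ K.closure.graph) :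
    (mulScalar φ f, mulScalar φ g + mulScalar φ' f) ∈ K.closure.graph := by
  rw [← hc.graph_closure_eq_closure_graph] at h ⊢
  have hcont : Continuous fun q : LpI T p X × LpI T p X =>
      (mulScalar φ q.1, mulScalar φ q.2 + mulScalar φ' q.1) := by fun_prop
  exact map_mem_closure (f := fun q : LpI T p X × LpI T p X =>
      (mulScalar φ q.1, mulScalar φ q.2 + mulScalar φ' q.1)) hcont h
    fun q hq => hK.mulScalar_mem_graph hw hq

/-- If the closure of an evolution pre-generator is a generator, it is an evolution generator. -/
theorem IsEvolutionPreGenerator.closure [CompleteSpace X] {T : ℝ} (hT : 0 < T) {p : ℝ≥0∞}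
    [Fact (1 ≤ p)] (hp : p ≠ ⊤) {K : LpI T p X →ₗ.[ℂ] LpI T p X}
    (hK : IsEvolutionPreGenerator K) (hc : K.IsClosable) (hgen : IsGenerator K.closure) :
    IsEvolutionGenerator K.closure := by
  obtain ⟨S, hS⟩ := id hgen
  have hmul : ∀ {φ φ' : LpI T ∞ ℂ}, HasWeakDeriv T φ φ' → ∀ {f g : LpI T p X},
      (f, g) ∈ K.closure.graph →
        (mulScalar φ f, mulScalar φ g + mulScalar φ' f) ∈ K.closure.graph :=
    fun hw _ _ h => mulScalar_mem_graph_closure hK hc hw h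
  obtain ⟨c, hc0, hbound⟩ := exists_ae_norm_le_of_mem_graph hT.le hp
    (hasCoordCommutator_of_forall hT.le hmul) hS
  have hle := LinearPMap.le_closure K
  have hcont : ∀ f ∈ K.closure.domain, ∃ u : ℝ → X, IsContRep T f u := by
    intro f hf
    have hfg := K.closure.mem_graph ⟨f, hf⟩
    rw [← hc.graph_closure_eq_closure_graph] at hfg
    obtain ⟨q, hq, hlim⟩ := mem_closure_iff_seq_limit.1 hfg
    have hq1 : ∀ n, (q n).1 ∈ K.domain := fun n =>
      LinearPMap.mem_domain_of_mem_graph (hq n : ((q n).1, (q n).2) ∈ K.graph)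
    choose u hu using fun n => hK.continuous_mem _ (hq1 n)
    rw [Prod.tendsto_iff] at hlim
    refine exists_isContRep_of_tendsto hu hlim.1 ?_
    -- The sup-norm bound for differences turns Cauchy images into uniformly Cauchy representatives.
    have hdiff : ∀ m n, ∀ t ∈ Icc 0 T, ‖u m t - u n t‖ ≤ c * ‖(q m).2 - (q n).2‖ := by
      intro m n t ht
      have hmem : ((q m).1 - (q n).1, (q m).2 - (q n).2) ∈ K.closure.graph :=
        LinearPMap.le_graph_of_le hle (K.graph.sub_mem (hq m) (hq n))
      refine le_of_ae_le_of_continuousOn (u := fun t => ‖u m t - u n t‖) (v := fun _ => _) hT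
        ((hu m).1.sub (hu n).1).norm continuousOn_const ?_ ht
      filter_upwards [hbound _ _ hmem, Lp.coeFn_sub (q m).1 (q n).1, (hu m).2, (hu n).2]
        with s h1 h2 h3 h4
      rwa [h2, Pi.sub_apply, h3, h4] at h1
    rw [Metric.uniformCauchySeqOn_iff]
    intro ε hε
    obtain ⟨N, hN⟩ := Metric.cauchySeq_iff.1 hlim.2.cauchySeq (ε / (c + 1)) (by positivity)
    refine ⟨N, fun m hm n hn t ht => ?_⟩
    rw [dist_eq_norm]
    have h1 := hN m hm n hn
    rw [dist_eq_norm, lt_div_iff₀ (by positivity)] at h1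
    refine (hdiff m n t ht).trans_lt (lt_of_le_of_lt ?_ h1)
    nlinarith [norm_nonneg ((q m).2 - (q n).2)]
  refine ⟨⟨hcont, ?_, ?_, hcont, ?_⟩, hgen⟩
  · exact fun φ φ' hw f hf =>
      LinearPMap.mem_domain_of_mem_graph (hmul hw (K.closure.mem_graph ⟨f, hf⟩))
  · intro φ φ' hw f
    rw [sub_eq_iff_eq_add']
    exact ((LinearPMap.image_iff _).2 (hmul hw (K.closure.mem_graph f))).symm
  · intro t ht
    refine (hK.dense_crossSection.2 t ht).mono ?_
    rintro x ⟨f, hf, u, hu⟩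
    exact ⟨f, hle.1 hf, u, hu⟩

end EvolCauchy

namespace EvolCauchy

variable {X : Type*} [NormedAddCommGroup X] [NormedSpace ℂ X]

/-! ### The propagator of an evolution generator -/

/-- The continuous representatives of the elements of a subspace can be chosen linearly. -/
theorem exists_linear_contRep {T : ℝ} (hT : 0 < T) {p : ℝ≥0∞} [Fact (1 ≤ p)]
    {D : Submodule ℂ (LpI T p X)} (hD : ∀ f ∈ D, ∃ u : ℝ → X, IsContRep T f u) :
    ∃ e : ℝ → D →ₗ[ℂ] X, ∀ f : D, IsContRep T (f : LpI T p X) fun t => e t f := by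
  choose u hu using fun f : D => hD f f.2
  have hadd : ∀ f g : D, EqOn (u (f + g)) (u f + u g) (Icc 0 T) := fun f g =>
    (hu (f + g)).eqOn hT ⟨(hu f).1.add (hu g).1,
      (Lp.coeFn_add (f : LpI T p X) g).trans ((hu f).2.add (hu g).2)⟩
  have hsmul : ∀ (c : ℂ) (f : D), EqOn (u (c • f)) (c • u f) (Icc 0 T) := fun c f =>
    (hu (c • f)).eqOn hT ⟨(hu f).1.const_smul c,
      (Lp.coeFn_smul c (f : LpI T p X)).trans ((hu f).2.const_smul c)⟩
  refine ⟨fun t =>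
    { toFun := fun f => (Icc 0 T).indicator (u f) t
      map_add' := fun f g => ?_
      map_smul' := fun c f => ?_ }, fun f => ⟨?_, ?_⟩⟩
  · by_cases ht : t ∈ Icc 0 T
    · simp only [indicator_of_mem ht, hadd f g ht, Pi.add_apply]
    · simp only [indicator_of_notMem ht, add_zero]
  · by_cases ht : t ∈ Icc 0 T
    · simp only [indicator_of_mem ht, hsmul c f ht, Pi.smul_apply, RingHom.id_apply]
    · simp only [indicator_of_notMem ht, smul_zero]
  · exact (hu f).1.congr fun t ht => indicator_of_mem ht _
  · filter_upwards [(hu f).2, ae_restrict_mem measurableSet_Icc] with t h1 h2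
    exact h1.trans (indicator_of_mem h2 (u f)).symm

/-- The semigroup acts linearly on the domain of its generator. -/
theorem IsGeneratorOf.exists_restrict_domain {E : Type*} [NormedAddCommGroup E] [NormedSpace ℂ E]
    {A : E →ₗ.[ℂ] E} {S : ℝ → E →L[ℂ] E} (hA : IsGeneratorOf A S) :
    ∃ R : ℝ → A.domain →ₗ[ℂ] A.domain, ∀ τ, 0 ≤ τ → ∀ x : A.domain,
      (R τ x : E) = S τ x ∧ A (R τ x) = S τ (A x) := by
  -- Truncating at $0$ gives a restriction for every real `τ`, although `S` is uncontrolled at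
  -- negative times.
  have h : ∀ τ : ℝ, ∀ x ∈ A.domain, (S (max τ 0)).toLinearMap x ∈ A.domain := fun τ x hx =>
    LinearPMap.mem_domain_of_mem_graph
      (hA.mem_orbit (A.mem_graph ⟨x, hx⟩) (le_max_right τ 0))
  refine ⟨fun τ => (S (max τ 0)).toLinearMap.restrict (h τ), fun τ hτ x => ?_⟩
  have e : (((S (max τ 0)).toLinearMap.restrict (h τ) x : A.domain) : E) = S τ x := by
    rw [LinearMap.coe_restrict_apply, max_eq_left hτ]
    rfl
  refine ⟨e, ?_⟩
  obtain ⟨y, hy1, hy2⟩ := (LinearPMap.mem_graph_iff A).1 (hA.mem_orbit (A.mem_graph x) hτ)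
  exact (congrArg A (Subtype.ext (e.trans hy1.symm))).trans hy2

section Propagator

variable [CompleteSpace X] {T : ℝ} {p : ℝ≥0∞} [Fact (1 ≤ p)]
  {K : LpI T p X →ₗ.[ℂ] LpI T p X} {S : ℝ → LpI T p X →L[ℂ] LpI T p X}

/-- The a.e. estimate holds everywhere by continuity. Strict `τ < T` keeps $[\tau,T]$ nondegenerate,
without which a.e. says nothing. -/
theorem norm_contRep_semigroup_le (hp : p ≠ ⊤) (hK : HasCoordCommutator K)
    (hS : IsGeneratorOf K S) {f : LpI T p X} {u v : ℝ → X} {τ : ℝ} (hu : IsContRep T f u)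
    (hv : IsContRep T (S τ f) v) (hτ : 0 ≤ τ) (hτT : τ < T) {t : ℝ} (ht : t ∈ Icc τ T) :
    ‖v t‖ ≤ ‖S τ‖ * ‖u (t - τ)‖ := by
  have hsub : Icc τ T ⊆ Icc 0 T := Icc_subset_Icc_left hτ
  refine le_of_ae_le_of_continuousOn (u := fun t => ‖v t‖) (v := fun t => ‖S τ‖ * ‖u (t - τ)‖) hτT
    (hv.1.mono hsub).norm (continuousOn_const.mul (hu.1.comp (by fun_prop) fun s hs =>
      ⟨sub_nonneg.2 hs.1, (sub_le_self s hτ).trans hs.2⟩).norm) ?_ ht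
  have := ae_restrict_of_ae_restrict_of_subset (μ := volume) hsub
    ((ae_norm_semigroup_le hp hK hS hτ f).and
      (hv.2.and (ae_intervalMeasure_comp_sub hτ hu.2)))
  filter_upwards [this, ae_restrict_mem measurableSet_Icc] with s hs hs'
  rw [← hs.2.1, ← hs.2.2 hs'.1]
  exact hs.1.1 hs'.1

/-- If the semigroup and the propagator correspond on the domain of `K`, they correspond. -/
theorem corresponds_of_forall_mem_domain (hp : p ≠ ⊤) (hK : HasCoordCommutator K)
    (hS : IsGeneratorOf K S) {U : ℝ → ℝ → X →L[ℂ] X}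
    (h : ∀ τ, 0 ≤ τ → ∀ f ∈ K.domain, ∀ᵐ t ∂(intervalMeasure T), τ < t →
      S τ f t = U t (t - τ) (f (t - τ))) : Corresponds S U := by
  intro τ hτ f
  obtain ⟨g, hg, hlim⟩ := mem_closure_iff_seq_limit.1 (hS.dense_domain f)
  obtain ⟨ns, hns, h1⟩ := (tendstoInMeasure_of_tendsto_Lp hlim).exists_seq_tendsto_ae
  have hlim2 : Tendsto (fun n => S τ (g (ns n))) atTop (𝓝 (S τ f)) :=
    ((S τ).continuous.tendsto f).comp (hlim.comp hns.tendsto_atTop)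
  obtain ⟨ms, hms, h2⟩ := (tendstoInMeasure_of_tendsto_Lp hlim2).exists_seq_tendsto_ae
  have h3 := ae_all_iff.2 fun n => h τ hτ (g n) (hg n)
  filter_upwards [ae_intervalMeasure_comp_sub hτ h1, h2, h3, ae_norm_semigroup_le hp hK hS hτ f,
    ae_restrict_mem measurableSet_Icc, ae_restrict_of_ae (Measure.ae_ne volume τ)]
    with t h1 h2 h3 h4 h5 h6
  split_ifs with hlt
  · have h7 := ((U t (t - τ)).continuous.tendsto _).comp ((h1 hlt.le).comp hms.tendsto_atTop)
    exact tendsto_nhds_unique h2 (h7.congr fun n => (h3 _ hlt).symm)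
  · exact h4.2 (lt_of_le_of_ne (not_lt.1 hlt) h6)

/-- Every evolution generator has a corresponding propagator. -/
theorem IsEvolutionPreGenerator.exists_propagator (hT : 0 < T) (hp : p ≠ ⊤)
    (hK : IsEvolutionPreGenerator K) (hS : IsGeneratorOf K S) :
    ∃ U : ℝ → ℝ → X →L[ℂ] X, IsPropagator T U ∧ Corresponds S U := by
  have hcc := hK.hasCoordCommutator hT.le
  obtain ⟨e, he⟩ := exists_linear_contRep hT hK.continuous_mem
  obtain ⟨R, hR⟩ := hS.exists_restrict_domain
  obtain ⟨M, hM0, hM⟩ := hS.1.exists_bound T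
  obtain ⟨c, hc0, hc⟩ := exists_ae_norm_le_of_mem_graph hT.le hp hcc hS
  have hsup : ∀ f : K.domain, ∀ t ∈ Icc 0 T, ‖e t f‖ ≤ c * ‖K f‖ := fun f t ht =>
    le_of_ae_le_of_continuousOn (u := fun t => ‖e t f‖) (v := fun _ => c * ‖K f‖) hT (he f).1.norm
      continuousOn_const (by
        filter_upwards [hc _ _ (K.mem_graph f), (he f).2] with s h1 h2
        rwa [← h2]) ht
  -- This makes $f(s)\mapsto(S(t-s)f)(t)$ well defined and uniformly bounded; $s>0$ ensures $t-s<T$.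
  have hbound : ∀ t s, 0 < s → s ≤ t → t ≤ T → ∀ f, ‖(e t ∘ₗ R (t - s)) f‖ ≤ M * ‖e s f‖ := by
    intro t s hs hst htT f
    have hτ : 0 ≤ t - s := sub_nonneg.2 hst
    have hrep := he (R (t - s) f)
    rw [(hR _ hτ f).1] at hrep
    have := norm_contRep_semigroup_le hp hcc hS (he f) hrep hτ (by linarith)
      (t := t) ⟨by linarith, htT⟩
    rw [sub_sub_cancel] at this
    exact this.trans (mul_le_mul_of_nonneg_right (hM _ ⟨hτ, by linarith⟩) (norm_nonneg _))
  have hdense : ∀ s ∈ Ioc 0 T, DenseRange (e s) := by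
    intro s hs
    refine (hK.dense_crossSection.2 s hs).mono ?_
    rintro x ⟨f, hf, u, hu, rfl⟩
    exact ⟨⟨f, hf⟩, (he ⟨f, hf⟩).eqOn hT hu (Ioc_subset_Icc_self hs)⟩
  let U : ℝ → ℝ → X →L[ℂ] X := fun t s => (e t ∘ₗ R (t - s)).extendOfNorm (e s)
  have hU : ∀ t s, 0 < s → s ≤ t → t ≤ T → ∀ f, U t s (e s f) = e t (R (t - s) f) :=
    fun t s hs hst htT f => LinearMap.extendOfNorm_eq (hdense s ⟨hs, hst.trans htT⟩)
      ⟨M, hbound t s hs hst htT⟩ f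
  have hUM : ∀ t s, 0 < s → s ≤ t → t ≤ T → ‖U t s‖ ≤ M := fun t s hs hst htT =>
    LinearMap.opNorm_extendOfNorm_le (hdense s ⟨hs, hst.trans htT⟩) hM0 (hbound t s hs hst htT)
  refine ⟨U, ⟨fun x => ?_, fun t ht htT => ?_, fun t r s hs hsr hrt htT => ?_, M, hUM⟩, ?_⟩
  · rintro ⟨t₀, s₀⟩ ⟨hs₀, hst₀, htT₀⟩
    simp only at hs₀ hst₀ htT₀
    set Δ := {q : ℝ × ℝ | 0 < q.2 ∧ q.2 ≤ q.1 ∧ q.1 ≤ T}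
    have hτ₀ : 0 ≤ t₀ - s₀ := sub_nonneg.2 hst₀
    have hs₀' : s₀ ∈ Icc 0 T := ⟨hs₀.le, hst₀.trans htT₀⟩
    have ht₀' : t₀ ∈ Icc 0 T := ⟨hs₀.le.trans hst₀, htT₀⟩
    have hmem : ∀ᶠ q in 𝓝[Δ] (t₀, s₀), q ∈ Δ := self_mem_nhdsWithin
    have lt : Tendsto (fun q : ℝ × ℝ => q.1) (𝓝[Δ] (t₀, s₀)) (𝓝[Icc 0 T] t₀) :=
      tendsto_nhdsWithin_iff.2 ⟨(continuous_fst.tendsto (t₀, s₀)).mono_left nhdsWithin_le_nhds,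
        hmem.mono fun q hq => ⟨hq.1.le.trans hq.2.1, hq.2.2⟩⟩
    have ls : Tendsto (fun q : ℝ × ℝ => q.2) (𝓝[Δ] (t₀, s₀)) (𝓝[Icc 0 T] s₀) :=
      tendsto_nhdsWithin_iff.2 ⟨(continuous_snd.tendsto (t₀, s₀)).mono_left nhdsWithin_le_nhds,
        hmem.mono fun q hq => ⟨hq.1.le, hq.2.1.trans hq.2.2⟩⟩
    have lts : Tendsto (fun q : ℝ × ℝ => q.1 - q.2) (𝓝[Δ] (t₀, s₀)) (𝓝 (t₀ - s₀)) :=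
      ((continuous_fst.sub continuous_snd).tendsto (t₀, s₀)).mono_left nhdsWithin_le_nhds
    -- The sup-norm bound reduces the change in $t-s$ to strong continuity of the semigroup at `K
    -- f`; the change in $t$ is continuity of one fixed representative.
    have hW : ∀ f, Tendsto (fun q : ℝ × ℝ => e q.1 (R (q.1 - q.2) f)) (𝓝[Δ] (t₀, s₀))
        (𝓝 (e t₀ (R (t₀ - s₀) f))) := by
      intro f
      have a1 := hS.1.tendsto_apply hτ₀ lts (hmem.mono fun q hq => sub_nonneg.2 hq.2.1)
        (tendsto_const_nhds (x := K f))
      have a2 : Tendsto (fun q : ℝ × ℝ => e q.1 (R (q.1 - q.2) f - R (t₀ - s₀) f))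
          (𝓝[Δ] (t₀, s₀)) (𝓝 0) := by
        have a3 : Tendsto (fun q : ℝ × ℝ => c * ‖S (q.1 - q.2) (K f) - S (t₀ - s₀) (K f)‖)
            (𝓝[Δ] (t₀, s₀)) (𝓝 0) := by
          simpa using (a1.sub_const (S (t₀ - s₀) (K f))).norm.const_mul c
        refine squeeze_zero_norm' (hmem.mono fun q hq => ?_) a3
        have := hsup (R (q.1 - q.2) f - R (t₀ - s₀) f) q.1 ⟨hq.1.le.trans hq.2.1, hq.2.2⟩
        rwa [LinearPMap.map_sub, (hR _ (sub_nonneg.2 hq.2.1) f).2, (hR _ hτ₀ f).2] at this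
      have a4 := ((he (R (t₀ - s₀) f)).1 t₀ ht₀').tendsto.comp lt
      simpa using a2.add a4
    rw [ContinuousWithinAt, Metric.tendsto_nhds]
    intro ε hε
    have hη : 0 < ε / (3 * (M + 1)) := by positivity
    -- One `f` serves all nearby $s$, since $f(s)$ stays close to $f(s_0)$. Dividing by $M+1$ covers
    -- $M=0$.
    obtain ⟨f, hf⟩ := (hdense s₀ ⟨hs₀, hs₀'.2⟩).exists_dist_lt x hη
    have hls := ((he f).1 s₀ hs₀').tendsto.comp ls
    have hx : ∀ᶠ q : ℝ × ℝ in 𝓝[Δ] (t₀, s₀), dist (e q.2 f) x < ε / (3 * (M + 1)) :=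
      (hls.dist tendsto_const_nhds).eventually_lt_const (by rwa [dist_comm])
    filter_upwards [hmem, hx, Metric.tendsto_nhds.1 (hW f) (ε / 3) (by positivity)]
      with q hq h1 h2
    have b1 : dist (U q.1 q.2 x) (U q.1 q.2 (e q.2 f)) ≤ M * dist x (e q.2 f) := by
      rw [dist_eq_norm, dist_eq_norm, ← map_sub]
      exact (U q.1 q.2).le_of_opNorm_le (hUM _ _ hq.1 hq.2.1 hq.2.2) _
    have b2 : dist (U t₀ s₀ (e s₀ f)) (U t₀ s₀ x) ≤ M * dist (e s₀ f) x := by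
      rw [dist_eq_norm, dist_eq_norm, ← map_sub]
      exact (U t₀ s₀).le_of_opNorm_le (hUM _ _ hs₀ hst₀ htT₀) _
    rw [← hU _ _ hq.1 hq.2.1 hq.2.2, ← hU _ _ hs₀ hst₀ htT₀] at h2
    have hM3 : ∀ d : ℝ, 0 ≤ d → d < ε / (3 * (M + 1)) → M * d < ε / 3 := by
      intro d hd0 hd
      rw [lt_div_iff₀ (by positivity)] at hd
      nlinarith
    have b3 := hM3 _ dist_nonneg h1
    have b4 := hM3 _ dist_nonneg hf
    rw [dist_comm x] at b1 b4
    linarith [dist_triangle4 (U q.1 q.2 x) (U q.1 q.2 (e q.2 f)) (U t₀ s₀ (e s₀ f)) (U t₀ s₀ x)]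
  · refine ContinuousLinearMap.coeFn_injective
      ((hdense t ⟨ht, htT⟩).equalizer (U t t).continuous continuous_id (funext fun f => ?_))
    have : R (t - t) f = f := Subtype.ext (by rw [(hR _ (sub_self t).ge f).1, sub_self, hS.1.zero]; rfl)
    rw [Function.comp_apply, hU t t ht le_rfl htT, this]
    rfl
  · refine ContinuousLinearMap.coeFn_injective
      ((hdense s ⟨hs, (hsr.trans hrt).trans htT⟩).equalizer (U t r * U r s).continuous
        (U t s).continuous (funext fun f => ?_))
    have h1 : R (t - r) (R (r - s) f) = R (t - s) f := Subtype.ext (by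
      rw [(hR _ (sub_nonneg.2 hrt) _).1, (hR _ (sub_nonneg.2 hsr) _).1,
        (hR _ (sub_nonneg.2 (hsr.trans hrt)) _).1, ← sub_add_sub_cancel t r s,
        hS.1.add _ _ (sub_nonneg.2 hrt) (sub_nonneg.2 hsr)]
      rfl)
    change U t r (U r s (e s f)) = U t s (e s f)
    rw [hU r s hs hsr (hrt.trans htT), hU t r (hs.trans_le hsr) hrt htT,
      hU t s hs (hsr.trans hrt) htT, h1]
  · refine corresponds_of_forall_mem_domain hp hcc hS fun τ hτ f hf => ?_
    have h1 := (he (R τ ⟨f, hf⟩)).2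
    rw [(hR τ hτ ⟨f, hf⟩).1] at h1
    filter_upwards [h1, ae_intervalMeasure_comp_sub hτ (he ⟨f, hf⟩).2,
      ae_restrict_mem measurableSet_Icc] with t h2 h3 h4 hlt
    have h5 := h3 hlt.le
    rw [h2, h5, hU t (t - τ) (sub_pos.2 hlt) (sub_le_self t hτ) h4.2, sub_sub_cancel]

end Propagator

/-- On a constant function with value `x` both propagators give the same a.e. values $U(r,r-\tau)x$,
with $\tau=t-s$; continuity in $r\in(\tau,T]$ reaches $r=t$. -/
theorem propagator_unique {T : ℝ} {p : ℝ≥0∞} [Fact (1 ≤ p)]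
    {S S' : ℝ → LpI T p X →L[ℂ] LpI T p X} (hSS : ∀ τ, 0 ≤ τ → S τ = S' τ)
    {U V : ℝ → ℝ → X →L[ℂ] X} (hU : IsPropagator T U) (hV : IsPropagator T V)
    (hSU : Corresponds S U) (hSV : Corresponds S' V) {t s : ℝ} (hs : 0 < s) (hst : s ≤ t)
    (htT : t ≤ T) : V t s = U t s := by
  refine ContinuousLinearMap.ext fun x => ?_
  have hτ : 0 ≤ t - s := sub_nonneg.2 hst
  have hτT : t - s < T := by linarith
  let f : LpI T p X := (memLp_const x).toLp (fun _ => x)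
  have hf : f =ᵐ[intervalMeasure T] fun _ => x := MemLp.coeFn_toLp _
  have h1 := hSU (t - s) hτ f
  have h2 := hSV (t - s) hτ f
  have hcont : ∀ {W : ℝ → ℝ → X →L[ℂ] X}, IsPropagator T W →
      ContinuousOn (fun r => W r (r - (t - s)) x) (Ioc (t - s) T) := fun hW =>
    (hW.continuousOn x).comp (f := fun r => (r, r - (t - s))) (by fun_prop)
      fun r hr => ⟨sub_pos.2 hr.1, sub_le_self r hτ, hr.2⟩
  have hae : (fun r => V r (r - (t - s)) x) =ᵐ[volume.restrict (Ioc (t - s) T)]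
      fun r => U r (r - (t - s)) x := by
    have hsub : Ioc (t - s) T ⊆ Icc 0 T := fun r hr => ⟨hτ.trans hr.1.le, hr.2⟩
    have := ae_restrict_of_ae_restrict_of_subset (μ := volume) hsub
      (h1.and (h2.and (ae_intervalMeasure_comp_sub hτ hf)))
    filter_upwards [this, ae_restrict_mem measurableSet_Ioc] with r hr hr'
    obtain ⟨a, b, d⟩ := hr
    rw [if_pos hr'.1, d hr'.1.le] at a b
    rw [← a, ← b, hSS _ hτ]
  have := Measure.eqOn_Ioc_of_ae_eq volume hae (hcont hV) (hcont hU)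
    (⟨by linarith, htT⟩ : t ∈ Ioc (t - s) T)
  simpa using this

end EvolCauchy

/-! ### The theorem: uniqueness of the extension and of the propagator -/

theorem mainTheorem9 {X : Type*} [NormedAddCommGroup X] [NormedSpace ℂ X] [CompleteSpace X]
    [TopologicalSpace.SeparableSpace X]
    (T : ℝ) (hT : 0 < T) (p : ℝ≥0∞) [Fact (1 ≤ p)] (hp : p ≠ ⊤)
    (C : ℝ → X →ₗ.[ℂ] X) (hC : ∀ t ∈ Icc 0 T, (C t).IsClosed)
    (hposed : EvolCauchy.IsCorrectlyPosed T p C)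
    (hclosable : (EvolCauchy.preGen T p C).IsClosable)
    (hgen : EvolCauchy.IsGenerator (EvolCauchy.preGen T p C).closure) :
    EvolCauchy.IsEvolutionGenerator (EvolCauchy.preGen T p C).closure ∧
    (∀ K : EvolCauchy.LpI T p X →ₗ.[ℂ] EvolCauchy.LpI T p X,
      EvolCauchy.preGen T p C ≤ K → EvolCauchy.IsEvolutionGenerator K →
        K = (EvolCauchy.preGen T p C).closure) ∧
    EvolCauchy.HasUniqueSolutionOperator T p C ∧
    ∃ U : ℝ → ℝ → X →L[ℂ] X, EvolCauchy.IsSolutionOperator T p C U ∧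
      ∀ V : ℝ → ℝ → X →L[ℂ] X, EvolCauchy.IsSolutionOperator T p C V →
        ∀ t s : ℝ, 0 < s → s ≤ t → t ≤ T → V t s = U t s := by
  have hev : EvolCauchy.IsEvolutionGenerator (EvolCauchy.preGen T p C).closure :=
    EvolCauchy.IsEvolutionPreGenerator.closure hT hp hposed hclosable hgen
  have hle := LinearPMap.le_closure (EvolCauchy.preGen T p C)
  obtain ⟨S, hS⟩ := hgen
  -- Closedness of a generator is what places the closure below every generator extending the sum.
  have hmin : ∀ (K : EvolCauchy.LpI T p X →ₗ.[ℂ] EvolCauchy.LpI T p X) S',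
      EvolCauchy.preGen T p C ≤ K → EvolCauchy.IsGeneratorOf K S' →
        (EvolCauchy.preGen T p C).closure ≤ K := fun K S' hK hS' => by
    have hcl := hS'.isClosed
    refine LinearPMap.le_of_le_graph ?_
    rw [← hclosable.graph_closure_eq_closure_graph]
    exact Submodule.topologicalClosure_minimal _ (LinearPMap.le_graph_of_le hK) hcl
  have huniq : ∀ K : EvolCauchy.LpI T p X →ₗ.[ℂ] EvolCauchy.LpI T p X,
      EvolCauchy.preGen T p C ≤ K → EvolCauchy.IsEvolutionGenerator K →
        K = (EvolCauchy.preGen T p C).closure := fun K hK hKev => by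
    obtain ⟨S', hS'⟩ := hKev.2
    exact (hS.eq_of_le hS' (hmin K S' hK hS')).symm
  refine ⟨hev, huniq, ⟨_, ⟨hle, hev⟩, fun K hK => huniq K hK.1 hK.2⟩, ?_⟩
  obtain ⟨U, hU, hSU⟩ := hev.1.exists_propagator hT hp hS
  refine ⟨U, ⟨hU, _, S, hev, hS, hSU, hle⟩, ?_⟩
  rintro V ⟨hV, K, S', -, hS', hSV, hK⟩ t s hs hst htT
  exact EvolCauchy.propagator_unique
    (fun τ hτ => hS.semigroup_eq_of_le hS' (hmin K S' hK hS') hτ) hU hV hSU hSV hs hst htT
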